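/- For an integer $k$ and $f\in L^1([-\pi,\pi])$ (complex-valued functions, Lebesgue measure) let $\hat f(k)=\frac1{2\pi}\int_{-\pi}^{\pi}f(x)e^{-ikx}\,dx$. Let $k_1,k_2,k_3,\dots$ be the enumeration $0,1,-1,2,-2,\dots$ of $\mathbb Z$, and let $\varphi_n(x)=e^{ik_nx}$, $n\ge1$, be the trigonometric system. Let $\Omega$ be a space of (classes of) measurable functions on $[-\pi,\pi]$ containing $L^1([-\pi,\pi])$ and equipped with a notion of convergence of sequences. A function $U\in L^1([-\pi,\pi])$ is called almost universal for $\Omega$ with respect to the trigonometric system if there are signs $\delta_n\in\{1,-1\}$, $n\ge1$, with $$\limsup_{n\to\infty}\frac{\#\{m\in\{1,\dots,n\}:\ \delta_m=1\}}{n}=1,$$ such that for every $f\in\Omega$ there is a strictly increasing sequence $N_1<N_2<\dots$ of natural numbers with $$\sum_{n=1}^{N_j}\delta_n\,\hat U(k_n)\,\varphi_n\longrightarrow f\quad\text{in }\Omega\quad\text{as }j\to\infty.$$ Corollary. There exists one function $U\in L^1([-\pi,\pi])$ which is almost universal with respect to the trigonometric system, in the above sense, 1. for $L^p([-\pi,\pi])$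 for every $p\in(0,1)$, with convergence $\int_{-\pi}^{\pi}|f_j-f|^p\,dx\to0$; 2. for $L^0([-\pi,\pi])$, the space of all complex-valued measurable functions on $[-\pi,\pi]$ modulo equality almost everywhere, with convergence in measure; 3. for $M([-\pi,\pi])$, the space of all complex-valued measurable functions on $[-\pi,\pi]$ modulo equality almost everywhere, with convergence almost everywhere. The signs $\delta_n$ may depend on the space. -/

import Mathlib

open MeasureTheory Filter Topology

open scoped ENNReal

noncomputable section

namespace AlmostUniv

/-- A biorthonormal system in `(X, X*)`: vectors `vec n` with continuous linear functionals
`coef n` such that `coef n (vec m) = δ_{n,m}`. The number `coef n f` is the `n`-th Fourier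
coefficient of `f`. The index `n : ℕ` starts at `0`. -/
structure BiorthonormalSystem (X : Type*) [NormedAddCommGroup X] [NormedSpace ℂ X] where
  vec : ℕ → X
  coef : ℕ → X →L[ℂ] ℂ
  biorthonormal : ∀ n m, coef n (vec m) = if n = m then 1 else 0

/-- A sequence `ξ` is universal with respect to the sequential convergence `conv` on `Ω` if every
element of `Ω` is the limit of a subsequence of `ξ`. -/
def IsUniversalSeq {Ω : Type*} (conv : (ℕ → Ω) → Ω → Prop) (ξ : ℕ → Ω) : Prop :=
  ∀ f : Ω, ∃ N : ℕ → ℕ, StrictMono N ∧ conv (fun k => ξ (N k)) f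

/-- The upper density `limsup #{m ∈ A | m is among the first n indices} / n` of a set of indices. -/
def upperDensity (A : Set ℕ) : ℝ :=
  open scoped Classical in
  limsup (fun n : ℕ => (((Finset.range n).filter (fun m => m ∈ A)).card : ℝ) / (n : ℝ)) atTop

/-- `U ∈ X` is almost universal for the space `Ω` (with sequential convergence `conv`, and `X`
embedded in `Ω` by `ι`) with respect to the system `S`, with multipliers in `G`: for some
`δ n ∈ G`, equal to `1` on a set of indices of upper density one, the partial sums of
`∑ δ n * c n (U) * φ n` are universal in `Ω`. -/
def IsAlmostUniversal {X Ω : Type*} [NormedAddCommGroup X] [NormedSpace ℂ X]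
    (G : Set ℂ) (conv : (ℕ → Ω) → Ω → Prop) (ι : X → Ω) (S : BiorthonormalSystem X)
    (U : X) : Prop :=
  ∃ δ : ℕ → ℂ, (∀ n, δ n ∈ G) ∧ upperDensity {m | δ m = 1} = 1 ∧
    IsUniversalSeq conv
      (fun N => ι (∑ n ∈ Finset.range N, (δ n * S.coef n U) • S.vec n))

/-- Lebesgue measure on `[-π, π]`. -/
abbrev torusMeasure : Measure ℝ := volume.restrict (Set.Icc (-Real.pi) Real.pi)

/-- The Banach space `L¹([-π, π])` of complex-valued functions. -/
abbrev L1 : Type := Lp ℂ 1 torusMeasure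

/-- Complex-valued measurable functions on `[-π, π]`, modulo equality almost everywhere. -/
abbrev MeasFun : Type := ℝ →ₘ[torusMeasure] ℂ

/-- Convergence in `L^p`, that is `∫ |f n - g|^p → 0` (used for `0 < p < 1`). -/
def LpConv (p : ℝ≥0∞) (f : ℕ → Lp ℂ p torusMeasure) (g : Lp ℂ p torusMeasure) : Prop :=
  Tendsto (fun n => eLpNorm (fun x => f n x - g x) p torusMeasure) atTop (𝓝 0)

/-- Convergence in measure. -/
def MeasureConv (f : ℕ → MeasFun) (g : MeasFun) : Prop :=
  TendstoInMeasure torusMeasure (fun n => (f n : ℝ → ℂ)) atTop (g : ℝ → ℂ)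

/-- Convergence almost everywhere. -/
def AEConv (f : ℕ → MeasFun) (g : MeasFun) : Prop :=
  ∀ᵐ x ∂torusMeasure, Tendsto (fun n => f n x) atTop (𝓝 (g x))

/-- The embedding of `L¹([-π, π])` in `L^p([-π, π])`, `p ≤ 1`. -/
def toLp (p : ℝ≥0∞) (hp : p ≤ 1) : L1 → Lp ℂ p torusMeasure :=
  AddSubgroup.inclusion (Lp.antitone hp)

/-- The embedding of `L¹([-π, π])` in the measurable functions. -/
def toMeasFun : L1 → MeasFun := fun f => f.1

/-- The standard order `0, 1, -1, 2, -2, …` of the integers. -/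
def freq (n : ℕ) : ℤ := if Even n then -((n / 2 : ℕ) : ℤ) else (((n + 1) / 2 : ℕ) : ℤ)

theorem freq_injective : Function.Injective freq := by
  intro a b h
  simp only [freq, Nat.even_iff] at h
  split_ifs at h <;> omega

/-- The function `x ↦ e^{ikx}`. -/
def expFun (k : ℤ) (x : ℝ) : ℂ := Complex.exp (Complex.I * k * x)

theorem continuous_expFun (k : ℤ) : Continuous (expFun k) := by
  unfold expFun; fun_prop

theorem norm_expFun (k : ℤ) (x : ℝ) : ‖expFun k x‖ = 1 := by
  have h : Complex.I * k * x = ((k * x : ℝ) : ℂ) * Complex.I := by push_cast; ring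
  rw [expFun, h, Complex.norm_exp_ofReal_mul_I]

theorem memLp_expFun (k : ℤ) : MemLp (expFun k) 1 torusMeasure :=
  MemLp.of_bound (continuous_expFun k).aestronglyMeasurable 1
    (Eventually.of_forall fun x => (norm_expFun k x).le)

theorem integrable_expFun_mul (k : ℤ) (f : L1) :
    Integrable (fun x => expFun k x * f x) torusMeasure :=
  (L1.integrable_coeFn f).bdd_mul (c := 1) (continuous_expFun k).aestronglyMeasurable
    (Eventually.of_forall fun x => (norm_expFun k x).le)

/-- The Fourier coefficient `f ↦ (2π)⁻¹ ∫_{-π}^{π} f(x) e^{-ikx} dx` as a continuous functional. -/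
def fourierCoefL1 (k : ℤ) : L1 →L[ℂ] ℂ :=
  LinearMap.mkContinuous
    { toFun := fun f => (2 * Real.pi : ℂ)⁻¹ * ∫ x, expFun (-k) x * f x ∂torusMeasure
      map_add' := by
        intro f g
        rw [← mul_add, ← integral_add (integrable_expFun_mul _ f) (integrable_expFun_mul _ g)]
        congr 1
        apply integral_congr_ae
        filter_upwards [Lp.coeFn_add f g] with x hx
        rw [hx, Pi.add_apply, mul_add]
      map_smul' := by
        intro a f
        rw [RingHom.id_apply, smul_eq_mul, mul_left_comm, ← integral_const_mul a]
        congr 1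
        apply integral_congr_ae
        filter_upwards [Lp.coeFn_smul a f] with x hx
        rw [hx, Pi.smul_apply, smul_eq_mul, mul_left_comm] }
    ‖(2 * Real.pi : ℂ)⁻¹‖ (by
      intro f
      change ‖(2 * Real.pi : ℂ)⁻¹ * ∫ x, expFun (-k) x * f x ∂torusMeasure‖ ≤ _
      rw [norm_mul, L1.norm_eq_integral_norm]
      gcongr
      refine (norm_integral_le_integral_norm _).trans (le_of_eq ?_)
      congr 1
      ext x
      rw [norm_mul, norm_expFun, one_mul])

theorem integral_expFun (k : ℤ) :
    ∫ x, expFun k x ∂torusMeasure = if k = 0 then (2 * Real.pi : ℂ) else 0 := by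
  have hpi : -Real.pi ≤ Real.pi := by linarith [Real.pi_pos]
  rw [integral_Icc_eq_integral_Ioc, ← intervalIntegral.integral_of_le hpi]
  split_ifs with hk
  · subst hk
    simp [expFun]
    ring
  · have hc : Complex.I * (k : ℂ) ≠ 0 := mul_ne_zero Complex.I_ne_zero (by exact_mod_cast hk)
    simp only [expFun]
    rw [integral_exp_mul_complex hc]
    have : Complex.exp (Complex.I * k * (Real.pi : ℝ))
        = Complex.exp (Complex.I * k * ((-Real.pi : ℝ) : ℂ)) := by
      rw [Complex.exp_eq_exp_iff_exists_int]
      exact ⟨k, by push_cast; ring⟩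
    rw [this, sub_self, zero_div]

theorem fourierCoefL1_expFun (k l : ℤ) :
    fourierCoefL1 k ((memLp_expFun l).toLp (expFun l)) = if k = l then 1 else 0 := by
  change (2 * Real.pi : ℂ)⁻¹ *
    ∫ x, expFun (-k) x * (memLp_expFun l).toLp (expFun l) x ∂torusMeasure = _
  have h : ∫ x, expFun (-k) x * (memLp_expFun l).toLp (expFun l) x ∂torusMeasure
      = ∫ x, expFun (l - k) x ∂torusMeasure := by
    apply integral_congr_ae
    filter_upwards [(memLp_expFun l).coeFn_toLp] with x hx
    rw [hx, expFun, expFun, expFun, ← Complex.exp_add]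
    congr 1
    push_cast
    ring
  have hp : (2 * Real.pi : ℂ) ≠ 0 := by
    exact_mod_cast (mul_pos two_pos Real.pi_pos).ne'
  rw [h, integral_expFun]
  by_cases hkl : k = l
  · rw [if_pos hkl, if_pos (by omega), inv_mul_cancel₀ hp]
  · have : l - k ≠ 0 := fun h0 => hkl (by omega)
    simp [hkl, this]

/-- The trigonometric system `1, e^{ix}, e^{-ix}, e^{2ix}, e^{-2ix}, …` in `L¹([-π, π])` with its
Fourier coefficients. -/
def trigSystem : BiorthonormalSystem L1 where
  vec n := (memLp_expFun (freq n)).toLp (expFun (freq n))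
  coef n := fourierCoefL1 (freq n)
  biorthonormal n m := by
    rw [fourierCoefL1_expFun]
    simp only [freq_injective.eq_iff]

end AlmostUniv

end

/-!
One sequence of signs serves all the spaces at once. It suffices that the signed partial sums come
arbitrarily close, in every `L^p` with `p < 1`, to each member of a sequence of trigonometric
polynomials that is dense in all these spaces: approximation in `L^p` is then immediate
(`exists_universal_series`), a measurable function is the pointwise limit of bounded truncations,
which can be approximated in `L^{1/2}`, so that a subsequence of the partial sums converges to it
almost everywhere, and this implies convergence in measure.

The function `U` is a sum of blocks with disjoint spectra. Each block is a polynomial `H` with high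
frequencies that is small in `L¹`, while a change of signs of its coefficients turns it into a
polynomial `Q` which is close in `L^p` to a given target, the difference of the next member of the
dense sequence and the signed sum of the earlier blocks (`exists_signPair_approx`,
`exists_blocks`). The gaps between the blocks are so long that most indices have coefficient zero
and sign `1`, which gives upper density one (`upperDensity_eq_one`).

To find `H` and `Q` for the target `g`, take `H(x) = g(x) h(Nx)` and `Q(x) = g(x) q(Nx)` with `N`
large. This reduces the problem to the target `1`: one needs `h` of mean zero, small in `L¹`, such
that a change of signs produces a real `q` with `1 - q` small in `L^p`. As in a Riesz product,
`1 - q = ∏ (1 - qⱼ(Nⱼ x))` with real factors of mean one (`exists_rieszProduct`). If `|qⱼ| ≤ 1` and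
the mean square of `qⱼ` is bounded below, concavity of the square root makes the mean of
`√(1 - qⱼ)` at most some constant less than one, and by the Riemann–Lebesgue lemma the dilated
factors behave as independent ones, so that the integral of the square root of the product
decreases geometrically (`IsOscillating.eventually_integral_mul_sqrt_lt`). As the product is
nonnegative of mean one, all its integrals with exponent `p < 1` become small.

It remains to make `qⱼ` small in `L¹` by changing signs. This is done by polynomials of
Rudin–Shapiro type (`exists_rudin_shapiro`, `exists_signPair_isOscillating`): they are bounded and
flat, while with all signs positive they become a normalized product `∏ (1 + e^{iNⱼx}) / √2`, whose
`L¹` norm decreases geometrically by the same contraction argument, as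
`|1 + e^{ix}| / √2 = √(1 + cos x)`.
-/

noncomputable section

namespace AlmostUniv

/-! ### Trigonometric polynomials -/

/-- Trigonometric polynomials, encoded by their finitely many nonzero coefficients: `f.coeff k` is
the coefficient of `e^{ikx}`, and the product is the convolution of coefficients. -/
abbrev TrigPoly : Type := AddMonoidAlgebra ℂ ℤ

theorem expFun_zero (x : ℝ) : expFun 0 x = 1 := by simp [expFun]

theorem expFun_add (k l : ℤ) (x : ℝ) : expFun (k + l) x = expFun k x * expFun l x := by
  rw [expFun, expFun, expFun, ← Complex.exp_add]
  congr 1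
  push_cast
  ring

theorem conj_expFun (k : ℤ) (x : ℝ) : (starRingEnd ℂ) (expFun k x) = expFun (-k) x := by
  rw [expFun, expFun, ← Complex.exp_conj]
  simp

theorem expFun_nat_mul (k : ℤ) (N : ℕ) (x : ℝ) : expFun (N * k) x = expFun k (N * x) := by
  rw [expFun, expFun]
  congr 1
  push_cast
  ring

theorem periodic_expFun (k : ℤ) : Function.Periodic (expFun k) (2 * Real.pi) := by
  intro x
  rw [expFun, expFun, Complex.exp_eq_exp_iff_exists_int]
  exact ⟨k, by push_cast; ring⟩

namespace TrigPoly

/-- The monomial `c e^{ikx}`. -/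
def mono (k : ℤ) (c : ℂ) : TrigPoly := AddMonoidAlgebra.single k c

@[simp]
theorem coeff_mono (k l : ℤ) (c : ℂ) : (mono k c).coeff l = if k = l then c else 0 :=
  Finsupp.single_apply

/-- The value at `x` of a trigonometric polynomial. -/
def ev (x : ℝ) : TrigPoly →ₐ[ℂ] ℂ :=
  AddMonoidAlgebra.lift ℂ ℂ ℤ
    { toFun := fun k => expFun k.toAdd x
      map_one' := by simp [expFun_zero]
      map_mul' := fun k l => by simp [expFun_add] }

@[simp]
theorem ev_mono (x : ℝ) (k : ℤ) (c : ℂ) : ev x (mono k c) = c * expFun k x := by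
  rw [mono, ev, AddMonoidAlgebra.lift_single]
  rfl

/-- A property closed under sums that holds for `0` and for all monomials holds for all
trigonometric polynomials. -/
theorem induction_mono {motive : TrigPoly → Prop} (f : TrigPoly) (zero : motive 0)
    (add : ∀ f g, motive f → motive g → motive (f + g))
    (mono : ∀ k c, motive (mono k c)) : motive f :=
  AddMonoidAlgebra.induction_linear f zero add mono

theorem continuous_ev (f : TrigPoly) : Continuous fun x => ev x f := by
  induction f using induction_mono with
  | zero => simpa using continuous_const
  | add f g hf hg => simp only [map_add]; exact hf.add hg
  | mono k c => simp only [ev_mono]; exact continuous_const.mul (continuous_expFun k)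

theorem periodic_ev (f : TrigPoly) : Function.Periodic (fun x => ev x f) (2 * Real.pi) := by
  intro x
  induction f using induction_mono with
  | zero => simp
  | add f g hf hg => simp only [map_add, hf, hg]
  | mono k c => simp only [ev_mono, periodic_expFun k x]

theorem exists_norm_ev_le (f : TrigPoly) : ∃ C : ℝ, 0 < C ∧ ∀ x, ‖ev x f‖ ≤ C := by
  induction f using induction_mono with
  | zero => exact ⟨1, one_pos, by simp⟩
  | add f g hf hg =>
    obtain ⟨C, hC, h⟩ := hf
    obtain ⟨C', hC', h'⟩ := hg
    refine ⟨C + C', by positivity, fun x => ?_⟩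
    rw [map_add]
    exact (norm_add_le _ _).trans (add_le_add (h x) (h' x))
  | mono k c =>
    refine ⟨‖c‖ + 1, by positivity, fun x => ?_⟩
    rw [ev_mono, norm_mul, norm_expFun]
    linarith

theorem integrable_ev (f : TrigPoly) : Integrable (fun x => ev x f) torusMeasure :=
  (continuous_ev f).continuousOn.integrableOn_compact isCompact_Icc

theorem integral_ev (f : TrigPoly) :
    ∫ x, ev x f ∂torusMeasure = 2 * Real.pi * f.coeff 0 := by
  induction f using induction_mono with
  | zero => simp
  | add f g hf hg =>
    simp only [map_add]
    rw [integral_add (integrable_ev f) (integrable_ev g), hf, hg]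
    simp [mul_add]
  | mono k c =>
    simp only [ev_mono]
    rw [integral_const_mul, integral_expFun]
    by_cases h : k = 0
    · simp [h, mul_comm]
    · simp [h]

/-- The dilation `x ↦ f (N x)` of a trigonometric polynomial. -/
def dil (N : ℕ) (f : TrigPoly) : TrigPoly := f.mapDomain (fun k => (N : ℤ) * k)

theorem dil_mono (N : ℕ) (k : ℤ) (c : ℂ) : dil N (mono k c) = mono (N * k) c := by
  exact AddMonoidAlgebra.mapDomain_single

theorem dil_add (N : ℕ) (f g : TrigPoly) : dil N (f + g) = dil N f + dil N g := by
  simp [dil, AddMonoidAlgebra.mapDomain_add]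

theorem dil_zero (N : ℕ) : dil N 0 = 0 := by simp [dil]

@[simp]
theorem ev_dil (x : ℝ) (N : ℕ) (f : TrigPoly) : ev x (dil N f) = ev (N * x) f := by
  induction f using induction_mono with
  | zero => simp [dil_zero]
  | add f g hf hg => simp [dil_add, hf, hg]
  | mono k c => rw [dil_mono, ev_mono, ev_mono, expFun_nat_mul]

/-- The complex conjugate of a trigonometric polynomial. -/
def conj (f : TrigPoly) : TrigPoly :=
  .ofCoeff ((f.coeff.equivMapDomain (Equiv.neg ℤ)).mapRange (starRingEnd ℂ) (map_zero _))

@[simp]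
theorem coeff_conj (f : TrigPoly) (k : ℤ) :
    (conj f).coeff k = (starRingEnd ℂ) (f.coeff (-k)) := by
  simp [conj]

@[simp]
theorem ev_conj (x : ℝ) (f : TrigPoly) : ev x (conj f) = (starRingEnd ℂ) (ev x f) := by
  induction f using induction_mono with
  | zero =>
    have : conj 0 = 0 := by ext k; simp
    simp [this]
  | add f g hf hg =>
    have : conj (f + g) = conj f + conj g := by ext k; simp
    simp [this, hf, hg]
  | mono k c =>
    have : conj (mono k c) = mono (-k) ((starRingEnd ℂ) c) := by
      ext l
      have h : k = -l ↔ -k = l := by omega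
      simp only [coeff_conj, coeff_mono, h, apply_ite (starRingEnd ℂ), map_zero]
    simp [this, conj_expFun]

theorem exists_degree_bound (f : TrigPoly) : ∃ d : ℕ, ∀ k : ℤ, (d : ℤ) < |k| → f.coeff k = 0 := by
  refine ⟨f.coeff.support.sup fun k => k.natAbs, fun k hk => ?_⟩
  by_contra h
  have : k.natAbs ≤ f.coeff.support.sup fun k => k.natAbs :=
    Finset.le_sup (f := fun k : ℤ => k.natAbs) (Finsupp.mem_support_iff.2 h)
  have h2 : |k| = k.natAbs := Int.abs_eq_natAbs k
  omega

theorem coeff_mul_mono (f : TrigPoly) (m k : ℤ) (c : ℂ) :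
    (f * mono m c).coeff k = f.coeff (k - m) * c := by
  rw [mono, AddMonoidAlgebra.coeff_mul_single_apply, sub_eq_add_neg]

theorem coeff_mul_dil (r h : TrigPoly) (N : ℕ) (k : ℤ) :
    (r * dil N h).coeff k = h.coeff.sum fun b c => r.coeff (k - N * b) * c := by
  induction h using induction_mono with
  | zero => simp [dil_zero]
  | add f g hf hg =>
    rw [dil_add, mul_add, AddMonoidAlgebra.coeff_add, Finsupp.add_apply, hf, hg,
      AddMonoidAlgebra.coeff_add, Finsupp.sum_add_index'] <;> simp [mul_add]
  | mono b c => rw [dil_mono, coeff_mul_mono, mono, AddMonoidAlgebra.coeff_single]; simp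

/-- If the degree of `r` is less than `N / 2`, the translates by multiples of `N` of the spectrum
of `r` are disjoint, so that every coefficient of `r(x) h(Nx)` is a product of one coefficient of
`r` and one coefficient of `h`. -/
theorem exists_coeff_mul_dil_eq {r : TrigPoly} {d N : ℕ}
    (hr : ∀ k : ℤ, (d : ℤ) < |k| → r.coeff k = 0) (hN : 2 * d < N) (k : ℤ) :
    ∃ b : ℤ, ∀ h : TrigPoly, (r * dil N h).coeff k = r.coeff (k - N * b) * h.coeff b := by
  by_cases hb : ∃ b : ℤ, |k - N * b| ≤ d
  · obtain ⟨b, hb⟩ := hb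
    refine ⟨b, fun h => ?_⟩
    rw [coeff_mul_dil, Finsupp.sum, Finset.sum_eq_single b]
    · intro b' _ hne
      have h1 : (d : ℤ) < |k - N * b'| := by
        by_contra hcon
        push Not at hcon
        have h2 : |(N : ℤ) * (b - b')| < N := by
          rw [abs_lt]
          rw [abs_le] at hb hcon
          constructor <;> linarith [hb.1, hb.2, hcon.1, hcon.2, (by exact_mod_cast hN :
            2 * (d : ℤ) < N), (by ring : (N : ℤ) * (b - b') = N * b - N * b')]
        rw [abs_mul, Nat.abs_cast] at h2
        have h3 : 1 ≤ |b - b'| := Int.one_le_abs (sub_ne_zero.2 (Ne.symm hne))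
        nlinarith
      rw [hr _ h1, zero_mul]
    · intro hnot
      rw [Finsupp.notMem_support_iff.1 hnot, mul_zero]
  · push Not at hb
    refine ⟨0, fun h => ?_⟩
    rw [coeff_mul_dil, hr _ (hb 0), zero_mul]
    exact Finset.sum_eq_zero fun b _ => by simp only [hr _ (hb b), zero_mul]

/-- If moreover `h` has mean zero, the spectrum of `r(x) h(Nx)` avoids the frequencies below
`N - d`. -/
theorem coeff_mul_dil_eq_zero {r h : TrigPoly} {d N : ℕ}
    (hr : ∀ k : ℤ, (d : ℤ) < |k| → r.coeff k = 0) (h0 : h.coeff 0 = 0) {k : ℤ}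
    (hk : |k| + d < N) : (r * dil N h).coeff k = 0 := by
  rw [coeff_mul_dil]
  refine Finset.sum_eq_zero fun b hb => ?_
  have hb0 : b ≠ 0 := by
    rintro rfl
    exact Finsupp.mem_support_iff.1 hb h0
  have h1 : (d : ℤ) < |k - N * b| := by
    have h2 : (N : ℤ) ≤ |(N : ℤ) * b| := by
      rw [abs_mul, Nat.abs_cast]
      nlinarith [Int.one_le_abs hb0, abs_nonneg b]
    have h3 := abs_sub_abs_le_abs_sub ((N : ℤ) * b) k
    rw [abs_sub_comm] at h3
    linarith
  simp only [hr _ h1, zero_mul]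

/-! ### Pairs of polynomials whose coefficients agree up to sign -/

/-- The coefficients of `g` are those of `f` up to signs. -/
def SignPair (f g : TrigPoly) : Prop := ∀ k, g.coeff k = f.coeff k ∨ g.coeff k = -f.coeff k

namespace SignPair

variable {f g f' g' : TrigPoly}

theorem coeff_eq_zero (h : SignPair f g) {k : ℤ} (hk : f.coeff k = 0) : g.coeff k = 0 := by
  rcases h k with h | h <;> simp [h, hk]

theorem refl (f : TrigPoly) : SignPair f f := fun _ => Or.inl rfl

theorem neg_right (h : SignPair f g) : SignPair f (-g) := fun k => by
  rcases h k with h | h <;> simp [h]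

theorem smul (h : SignPair f g) (c : ℂ) : SignPair (c • f) (c • g) := fun k => by
  rcases h k with h | h <;> simp [h]

theorem conj (h : SignPair f g) : SignPair (conj f) (conj g) := fun k => by
  rcases h (-k) with h | h <;> simp [h]

theorem mul_mono (h : SignPair f g) (m : ℤ) (c : ℂ) :
    SignPair (f * mono m c) (g * mono m c) := fun k => by
  simp only [coeff_mul_mono]
  rcases h (k - m) with h | h <;> simp [h]

theorem add (h : SignPair f g) (h' : SignPair f' g')
    (hd : ∀ k, f.coeff k = 0 ∨ f'.coeff k = 0) : SignPair (f + f') (g + g') := fun k => by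
  rcases hd k with hk | hk
  · simpa [hk, h.coeff_eq_zero hk] using h' k
  · simpa [hk, h'.coeff_eq_zero hk] using h k

theorem mul_dil (h : SignPair f g) {r : TrigPoly} {d N : ℕ}
    (hr : ∀ k : ℤ, (d : ℤ) < |k| → r.coeff k = 0) (hN : 2 * d < N) :
    SignPair (r * dil N f) (r * dil N g) := fun k => by
  obtain ⟨b, hb⟩ := exists_coeff_mul_dil_eq hr hN k
  rw [hb, hb]
  rcases h b with h | h <;> simp [h]

end SignPair

end TrigPoly

/-! ### Dilations and the Riemann–Lebesgue lemma -/

/-- The mean of a periodic function is not changed by a dilation with an integral factor. -/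
theorem integral_dilation_eq {F : ℝ → ℝ} (hc : Continuous F)
    (hp : Function.Periodic F (2 * Real.pi)) {N : ℕ} (hN : 0 < N) :
    ∫ x, F (N * x) ∂torusMeasure = ∫ x, F x ∂torusMeasure := by
  have hpi : -Real.pi ≤ Real.pi := by linarith [Real.pi_pos]
  have hN' : (N : ℝ) ≠ 0 := by positivity
  have h := hp.intervalIntegral_add_zsmul_eq N (-(N * Real.pi))
    (fun a b => hc.intervalIntegrable a b)
  rw [hp.intervalIntegral_add_eq (-(N * Real.pi)) (-Real.pi)] at h
  rw [integral_Icc_eq_integral_Ioc, integral_Icc_eq_integral_Ioc,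
    ← intervalIntegral.integral_of_le hpi, ← intervalIntegral.integral_of_le hpi,
    intervalIntegral.integral_comp_mul_left F hN']
  have e1 : (N : ℝ) * -Real.pi = -(N * Real.pi) := by ring
  have e2 : -(N * Real.pi) + (N : ℤ) • (2 * Real.pi) = N * Real.pi := by
    rw [zsmul_eq_mul]; push_cast; ring
  have e3 : -Real.pi + 2 * Real.pi = Real.pi := by ring
  rw [e2, e3] at h
  rw [e1, h, zsmul_eq_mul, smul_eq_mul, Int.cast_natCast, inv_mul_cancel_left₀ hN']

theorem tendsto_integral_mul_expFun {f : ℝ → ℂ} {k : ℤ} (hk : k ≠ 0) :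
    Tendsto (fun N : ℕ => ∫ x, f x * expFun k (N * x) ∂torusMeasure) atTop (𝓝 0) := by
  have h := Real.tendsto_integral_exp_smul_cocompact
    ((Set.Icc (-Real.pi) Real.pi).indicator f)
  have hw : Tendsto (fun N : ℕ => (N : ℝ) * (-(k : ℝ) / (2 * Real.pi))) atTop (cocompact ℝ) := by
    have hc : -(k : ℝ) / (2 * Real.pi) ≠ 0 :=
      div_ne_zero (neg_ne_zero.2 (by exact_mod_cast hk)) (by positivity)
    rw [← Metric.cobounded_eq_cocompact]
    refine tendsto_norm_atTop_iff_cobounded.1 ?_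
    simp only [norm_mul, Real.norm_natCast]
    exact tendsto_natCast_atTop_atTop.atTop_mul_const (norm_pos_iff.2 hc)
  refine (h.comp hw).congr fun N => ?_
  rw [← integral_indicator measurableSet_Icc, Function.comp]
  congr 1
  ext x
  by_cases hx : x ∈ Set.Icc (-Real.pi) Real.pi
  · rw [Set.indicator_of_mem hx, Set.indicator_of_mem hx, Circle.smul_def, Real.fourierChar_apply,
      smul_eq_mul, mul_comm, expFun]
    congr 2
    have : (Real.pi : ℂ) ≠ 0 := by exact_mod_cast Real.pi_ne_zero
    push_cast
    field_simp
  · rw [Set.indicator_of_notMem hx, Set.indicator_of_notMem hx, smul_zero]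

theorem tendsto_integral_mul_ev_dil {f : ℝ → ℂ} (hf : Integrable f torusMeasure) (T : TrigPoly) :
    Tendsto (fun N : ℕ => ∫ x, f x * TrigPoly.ev (N * x) T ∂torusMeasure) atTop
      (𝓝 (T.coeff 0 * ∫ x, f x ∂torusMeasure)) := by
  have hint : ∀ (T : TrigPoly) (N : ℕ),
      Integrable (fun x => f x * TrigPoly.ev (N * x) T) torusMeasure := by
    intro T N
    obtain ⟨C, -, hC⟩ := T.exists_norm_ev_le
    exact hf.mul_bdd (c := C)
      ((T.continuous_ev.comp (continuous_const.mul continuous_id)).aestronglyMeasurable)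
      (Eventually.of_forall fun x => hC _)
  induction T using TrigPoly.induction_mono with
  | zero => simp
  | add T T' h h' =>
    rw [AddMonoidAlgebra.coeff_add, Finsupp.add_apply, add_mul]
    refine (h.add h').congr fun N => ?_
    rw [← integral_add (hint T N) (hint T' N)]
    congr 1
    ext x
    rw [map_add, mul_add]
  | mono k c =>
    simp only [TrigPoly.ev_mono, TrigPoly.coeff_mono]
    by_cases hk : k = 0
    · simp only [hk, expFun_zero, if_true, mul_one]
      rw [integral_mul_const, mul_comm]
      exact tendsto_const_nhds
    · rw [if_neg hk, zero_mul, ← mul_zero c]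
      refine ((tendsto_integral_mul_expFun (f := f) hk).const_mul c).congr fun N => ?_
      rw [← integral_const_mul]
      congr 1
      ext x
      ring

/-! ### Strict contraction of the integral of a square root -/

/-- A quadratic majorant of `t ↦ √(1 - t)` on `[-1, 1]`; its quadratic term makes Jensen's
inequality strict. -/
theorem sqrt_one_sub_le {t : ℝ} (ht : |t| ≤ 1) :
    √(1 - t) ≤ 1 - t / 2 - t ^ 2 / 12 := by
  rw [abs_le] at ht
  have h0 : 0 ≤ 1 - t := by linarith
  have hs := Real.sq_sqrt h0
  have hs0 := Real.sqrt_nonneg (1 - t)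
  set s := √(1 - t)
  have hs2 : s ≤ 3 / 2 := by nlinarith
  have e : t = 1 - s ^ 2 := by linarith
  have key : 1 - t / 2 - t ^ 2 / 12 - s = (1 - s) ^ 2 * (1 / 2 - (1 + s) ^ 2 / 12) := by
    rw [e]; ring
  have hs3 : s ^ 2 ≤ 2 := by linarith
  have h4 : (1 + s) ^ 2 / 12 ≤ 1 / 2 := by nlinarith [sq_nonneg (s - 3 / 2)]
  have := mul_nonneg (sq_nonneg (1 - s)) (sub_nonneg.2 h4)
  linarith

/-- Real trigonometric polynomials of mean zero with values in `[-1, 1]` and with mean square at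
least `1 / 4`. -/
structure IsOscillating (q : TrigPoly) : Prop where
  coeff_zero : q.coeff 0 = 0
  im_eq_zero : ∀ x, (TrigPoly.ev x q).im = 0
  abs_re_le : ∀ x, |(TrigPoly.ev x q).re| ≤ 1
  le_integral_sq : Real.pi / 2 ≤ ∫ x, (TrigPoly.ev x q).re ^ 2 ∂torusMeasure

theorem ev_eq_re {q : TrigPoly} {x : ℝ} (h : (TrigPoly.ev x q).im = 0) :
    TrigPoly.ev x q = ((TrigPoly.ev x q).re : ℂ) :=
  Complex.ext (by simp) (by simp [h])

/-- Multiplication by the square root of `1 - q(Nx)`, with `q` oscillating and `N` large,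
decreases an integral by a fixed factor: by the Riemann–Lebesgue lemma the quadratic majorant
`1 - q/2 - q²/12` acts on the integral as multiplication by its mean. -/
theorem IsOscillating.eventually_integral_mul_sqrt_lt {q : TrigPoly} (hq : IsOscillating q)
    {φ : ℝ → ℝ} (hφ : Integrable φ torusMeasure) (hφ0 : ∀ x, 0 ≤ φ x) {c : ℝ}
    (hc : ∫ x, φ x ∂torusMeasure < c) :
    ∀ᶠ N : ℕ in atTop,
      ∫ x, φ x * √(1 - (TrigPoly.ev (N * x) q).re) ∂torusMeasure < 47 / 48 * c := by
  set T : TrigPoly := 1 - (1 / 2 : ℂ) • q - (1 / 12 : ℂ) • (q * q) with hT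
  set τ : ℝ → ℝ := fun y => 1 - (TrigPoly.ev y q).re / 2 - (TrigPoly.ev y q).re ^ 2 / 12 with hτ
  have hTτ : ∀ y, TrigPoly.ev y T = (τ y : ℂ) := by
    intro y
    rw [hT, map_sub, map_sub, map_one, map_smul, map_smul, map_mul, ev_eq_re (hq.im_eq_zero y), hτ]
    simp only [smul_eq_mul]
    push_cast
    ring
  have hT0 : ∃ m : ℝ, T.coeff 0 = m ∧ m ≤ 47 / 48 := by
    have h1 : ∫ x, TrigPoly.ev x (q * q) ∂torusMeasure
        = ((∫ x, (TrigPoly.ev x q).re ^ 2 ∂torusMeasure : ℝ) : ℂ) := by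
      rw [← integral_complex_ofReal]
      congr 1
      ext x
      rw [map_mul, ev_eq_re (hq.im_eq_zero x)]
      simp [sq]
    rw [TrigPoly.integral_ev] at h1
    have hpi : (2 * Real.pi : ℂ) ≠ 0 := by exact_mod_cast (mul_pos two_pos Real.pi_pos).ne'
    have h2 : (q * q).coeff 0
        = (((2 * Real.pi)⁻¹ * ∫ x, (TrigPoly.ev x q).re ^ 2 ∂torusMeasure : ℝ) : ℂ) := by
      push_cast
      rw [← h1, inv_mul_cancel_left₀ hpi]
    refine ⟨1 - (1 / 12) * ((2 * Real.pi)⁻¹ * ∫ x, (TrigPoly.ev x q).re ^ 2 ∂torusMeasure),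
      ?_, ?_⟩
    · have h3 : (1 : TrigPoly).coeff 0 = 1 := AddMonoidAlgebra.coeff_one_zero
      simp only [hT, AddMonoidAlgebra.coeff_sub, AddMonoidAlgebra.coeff_smul, Finsupp.sub_apply,
        Finsupp.smul_apply, h3, hq.coeff_zero, h2, smul_eq_mul]
      push_cast
      ring
    · have h4 : (2 * Real.pi)⁻¹ * (Real.pi / 2)
          ≤ (2 * Real.pi)⁻¹ * ∫ x, (TrigPoly.ev x q).re ^ 2 ∂torusMeasure :=
        mul_le_mul_of_nonneg_left hq.le_integral_sq (by positivity)
      have h5 : (2 * Real.pi)⁻¹ * (Real.pi / 2) = 1 / 4 := by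
        field_simp
        norm_num
      linarith
  obtain ⟨m, hm, hm'⟩ := hT0
  have hlim : Tendsto (fun N : ℕ => ∫ x, φ x * τ (N * x) ∂torusMeasure) atTop
      (𝓝 (m * ∫ x, φ x ∂torusMeasure)) := by
    have h := tendsto_integral_mul_ev_dil hφ.ofReal T (f := fun x => (φ x : ℂ))
    simp only [hTτ, hm, ← Complex.ofReal_mul] at h
    rw [integral_complex_ofReal, ← Complex.ofReal_mul] at h
    simp only [integral_complex_ofReal] at h
    exact (Complex.continuous_re.tendsto _).comp h
  have hφint : 0 ≤ ∫ x, φ x ∂torusMeasure := integral_nonneg hφ0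
  have hlt : m * ∫ x, φ x ∂torusMeasure < 47 / 48 * c := by nlinarith
  have hcont : Continuous fun y => (TrigPoly.ev y q).re :=
    Complex.continuous_re.comp q.continuous_ev
  filter_upwards [hlim.eventually_lt_const hlt] with N hN
  have hcN : Continuous fun x : ℝ => (TrigPoly.ev (N * x) q).re :=
    hcont.comp (continuous_const.mul continuous_id)
  refine lt_of_le_of_lt (integral_mono ?_ ?_ fun x => ?_) hN
  · refine hφ.mul_bdd (c := 2) (by exact (Real.continuous_sqrt.comp
      (continuous_const.sub hcN)).aestronglyMeasurable) (Eventually.of_forall fun x => ?_)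
    rw [Real.norm_of_nonneg (Real.sqrt_nonneg _), Real.sqrt_le_iff]
    have := abs_le.1 (hq.abs_re_le (N * x))
    constructor <;> linarith
  · refine hφ.mul_bdd (c := 2) (by exact ((continuous_const.sub (hcN.div_const _)).sub
      ((hcN.pow 2).div_const _)).aestronglyMeasurable) (Eventually.of_forall fun x => ?_)
    have := abs_le.1 (hq.abs_re_le (N * x))
    rw [hτ, Real.norm_eq_abs, abs_le]
    constructor <;> nlinarith
  · exact mul_le_mul_of_nonneg_left (sqrt_one_sub_le (hq.abs_re_le _)) (hφ0 x)

/-! ### Flat polynomials of Rudin–Shapiro type -/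

/-- The polynomial `-cos x`. -/
def negCos : TrigPoly := (-1 / 2 : ℂ) • (TrigPoly.mono 1 1 + TrigPoly.mono (-1) 1)

theorem ev_negCos (x : ℝ) : TrigPoly.ev x negCos = ((-Real.cos x : ℝ) : ℂ) := by
  rw [negCos, map_smul, map_add, TrigPoly.ev_mono, TrigPoly.ev_mono, expFun, expFun]
  push_cast
  rw [Complex.cos, smul_eq_mul]
  ring_nf

theorem isOscillating_negCos : IsOscillating negCos where
  coeff_zero := by simp [negCos]
  im_eq_zero x := by rw [ev_negCos, Complex.ofReal_im]
  abs_re_le x := by rw [ev_negCos, Complex.ofReal_re, abs_neg]; exact Real.abs_cos_le_one x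
  le_integral_sq := by
    have hpi : -Real.pi ≤ Real.pi := by linarith [Real.pi_pos]
    simp only [ev_negCos, Complex.ofReal_re, neg_sq]
    rw [integral_Icc_eq_integral_Ioc, ← intervalIntegral.integral_of_le hpi, integral_cos_sq]
    simp
    linarith [Real.pi_pos]

theorem norm_one_add_expFun (x : ℝ) :
    (√2)⁻¹ * ‖1 + expFun 1 x‖ = √(1 - (TrigPoly.ev x negCos).re) := by
  have h2 : (0 : ℝ) < √2 := by positivity
  have h : ‖1 + expFun 1 x‖ ^ 2 = 2 * (1 + Real.cos x) := by
    have e : expFun 1 x = Real.cos x + Real.sin x * Complex.I := by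
      rw [expFun, Complex.ofReal_cos, Complex.ofReal_sin, ← Complex.exp_mul_I]
      congr 1
      push_cast
      ring
    rw [Complex.sq_norm, Complex.normSq_apply, e]
    simp only [Complex.add_re, Complex.one_re, Complex.ofReal_re, Complex.mul_re, Complex.I_re,
      Complex.I_im, Complex.ofReal_im, Complex.add_im, Complex.one_im, Complex.mul_im]
    nlinarith [Real.sin_sq_add_cos_sq x]
  rw [ev_negCos, Complex.ofReal_re, sub_neg_eq_add]
  rw [eq_comm, Real.sqrt_eq_iff_mul_self_eq (by nlinarith [sq_nonneg ‖1 + expFun 1 x‖])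
    (by positivity), ← sq, mul_pow, h, inv_pow, Real.sq_sqrt (by norm_num)]
  ring

/-- The Rudin–Shapiro recursion with rapidly growing frequencies. The polynomials `P` and `Q` have
the coefficients of `D` up to signs and stay bounded by `1`, while `D` is a normalized product
`∏ (1 + e^{iNx}) / √2`, whose integral norm decreases geometrically. -/
theorem exists_rudin_shapiro (n : ℕ) : ∃ D P Q : TrigPoly, D.SignPair P ∧ D.SignPair Q ∧
    (∀ x, ‖TrigPoly.ev x P‖ ^ 2 + ‖TrigPoly.ev x Q‖ ^ 2 = 1) ∧
    ∫ x, ‖TrigPoly.ev x D‖ ∂torusMeasure < 10 * (47 / 48) ^ n := by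
  have hs : ‖(((√2)⁻¹ : ℝ) : ℂ)‖ = (√2)⁻¹ := by
    rw [Complex.norm_real, Real.norm_of_nonneg (by positivity)]
  have hs2 : ((√2)⁻¹ : ℝ) ^ 2 = 1 / 2 := by
    rw [inv_pow, Real.sq_sqrt (by norm_num)]
    norm_num
  induction n with
  | zero =>
    refine ⟨.mono 0 ((√2)⁻¹ : ℝ), .mono 0 ((√2)⁻¹ : ℝ), .mono 0 ((√2)⁻¹ : ℝ), .refl _, .refl _,
      fun x => ?_, ?_⟩
    · rw [TrigPoly.ev_mono, expFun_zero, mul_one, hs, hs2]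
      norm_num
    · simp only [TrigPoly.ev_mono, expFun_zero, mul_one, hs]
      have h1 : ((√2)⁻¹ : ℝ) ≤ 1 := by
        by_contra hcon
        push Not at hcon
        nlinarith
      rw [integral_const, measureReal_restrict_apply_univ, Real.volume_real_Icc_of_le
        (by linarith [Real.pi_pos]), smul_eq_mul]
      nlinarith [Real.pi_pos, Real.pi_lt_d2]
  | succ n ih =>
    obtain ⟨D, P, Q, hP, hQ, hsq, hD⟩ := ih
    obtain ⟨d, hd⟩ := D.exists_degree_bound
    have hlarge := isOscillating_negCos.eventually_integral_mul_sqrt_lt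
      D.integrable_ev.norm (fun x => norm_nonneg _) hD
    obtain ⟨N, hN, hNd⟩ := (hlarge.and (eventually_gt_atTop (2 * d))).exists
    have hdisj : ∀ k, D.coeff k = 0 ∨ (D * .mono N 1).coeff k = 0 := by
      intro k
      by_cases hk : (d : ℤ) < |k|
      · exact Or.inl (hd k hk)
      · right
        rw [TrigPoly.coeff_mul_mono, hd, zero_mul]
        rw [not_lt, abs_le] at hk
        rw [lt_abs]
        omega
    have hP' := (hP.add (hQ.mul_mono N 1) hdisj).smul (((√2)⁻¹ : ℝ) : ℂ)
    have hQ' := (hP.add (hQ.mul_mono N 1).neg_right hdisj).smul (((√2)⁻¹ : ℝ) : ℂ)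
    refine ⟨_, _, _, hP', hQ', fun x => ?_, ?_⟩
    · have h := parallelogram_law_with_norm ℂ (TrigPoly.ev x P) (TrigPoly.ev x (Q * .mono N 1))
      have h1 : ‖TrigPoly.ev x (Q * .mono N 1)‖ = ‖TrigPoly.ev x Q‖ := by
        rw [map_mul, TrigPoly.ev_mono, one_mul, norm_mul, norm_expFun, mul_one]
      rw [h1] at h
      rw [map_smul, map_smul, map_add, map_add, map_neg, norm_smul, norm_smul, hs, mul_pow,
        mul_pow, hs2, ← sub_eq_add_neg]
      linarith [hsq x]
    · have e : ∀ x, ‖TrigPoly.ev x ((((√2)⁻¹ : ℝ) : ℂ) • (D + D * .mono N 1))‖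
          = ‖TrigPoly.ev x D‖ * √(1 - (TrigPoly.ev (N * x) negCos).re) := by
        intro x
        rw [← norm_one_add_expFun, ← expFun_nat_mul, mul_one, map_smul, map_add, map_mul,
          TrigPoly.ev_mono, one_mul, smul_eq_mul, ← mul_one_add, norm_mul, norm_mul, hs]
        ring
      simp only [e]
      rw [pow_succ]
      linarith

/-- The real part of a trigonometric polynomial. -/
def TrigPoly.rePart (f : TrigPoly) : TrigPoly := (1 / 2 : ℂ) • (f + f.conj)

theorem TrigPoly.ev_rePart (x : ℝ) (f : TrigPoly) :
    TrigPoly.ev x f.rePart = ((TrigPoly.ev x f).re : ℂ) := by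
  rw [TrigPoly.rePart, map_smul, map_add, TrigPoly.ev_conj, Complex.add_conj, smul_eq_mul]
  push_cast
  ring

/-- As `|P|² + |Q|² = 1` for the Rudin–Shapiro polynomials, one of the two has mean square at least
`1 / 2`. -/
theorem exists_signPair_bounded {ε : ℝ} (hε : 0 < ε) : ∃ D P : TrigPoly, D.SignPair P ∧
    (∀ x, ‖TrigPoly.ev x P‖ ≤ 1) ∧ Real.pi ≤ ∫ x, ‖TrigPoly.ev x P‖ ^ 2 ∂torusMeasure ∧
    ∫ x, ‖TrigPoly.ev x D‖ ∂torusMeasure < ε := by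
  obtain ⟨n, hn⟩ := exists_pow_lt_of_lt_one (show (0 : ℝ) < ε / 10 by positivity)
    (show (47 / 48 : ℝ) < 1 by norm_num)
  obtain ⟨D, P, Q, hP, hQ, hsq, hD⟩ := exists_rudin_shapiro n
  have hDε : ∫ x, ‖TrigPoly.ev x D‖ ∂torusMeasure < ε := by linarith
  have hint : ∀ f : TrigPoly, Integrable (fun x => ‖TrigPoly.ev x f‖ ^ 2) torusMeasure :=
    fun f => (f.continuous_ev.norm.pow 2).continuousOn.integrableOn_compact isCompact_Icc
  have hsum : ∫ x, ‖TrigPoly.ev x P‖ ^ 2 ∂torusMeasure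
      + ∫ x, ‖TrigPoly.ev x Q‖ ^ 2 ∂torusMeasure = 2 * Real.pi := by
    rw [← integral_add (hint P) (hint Q)]
    simp only [hsq]
    rw [integral_const, measureReal_restrict_apply_univ, Real.volume_real_Icc_of_le
      (by linarith [Real.pi_pos]), smul_eq_mul]
    ring
  by_cases hcase : Real.pi ≤ ∫ x, ‖TrigPoly.ev x P‖ ^ 2 ∂torusMeasure
  · refine ⟨D, P, hP, fun x => ?_, hcase, hDε⟩
    have := hsq x
    nlinarith [norm_nonneg (TrigPoly.ev x P), sq_nonneg ‖TrigPoly.ev x Q‖]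
  · refine ⟨D, Q, hQ, fun x => ?_, by linarith, hDε⟩
    have := hsq x
    nlinarith [norm_nonneg (TrigPoly.ev x Q), sq_nonneg ‖TrigPoly.ev x P‖]

/-- One of the real and imaginary parts of `e^{imx} P(x)` has at least half the mean square
of `P`. -/
theorem exists_integral_re_sq_ge (P : TrigPoly) (m : ℤ) : ∃ u : ℂ, ‖u‖ = 1 ∧
    (∫ x, ‖TrigPoly.ev x P‖ ^ 2 ∂torusMeasure) / 2 ≤
      ∫ x, (TrigPoly.ev x (P * .mono m u)).re ^ 2 ∂torusMeasure := by
  have hint : ∀ f : TrigPoly, Integrable (fun x => (TrigPoly.ev x f).re ^ 2) torusMeasure :=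
    fun f => ((Complex.continuous_re.comp f.continuous_ev).pow 2).continuousOn.integrableOn_compact
      isCompact_Icc
  have hsum : ∫ x, (TrigPoly.ev x (P * .mono m 1)).re ^ 2 ∂torusMeasure
      + ∫ x, (TrigPoly.ev x (P * .mono m Complex.I)).re ^ 2 ∂torusMeasure
      = ∫ x, ‖TrigPoly.ev x P‖ ^ 2 ∂torusMeasure := by
    rw [← integral_add (hint _) (hint _)]
    congr 1
    ext x
    have e1 : ‖TrigPoly.ev x P‖ = ‖TrigPoly.ev x (P * .mono m 1)‖ := by
      rw [map_mul, TrigPoly.ev_mono, one_mul, norm_mul, norm_expFun, mul_one]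
    have e2 : TrigPoly.ev x (P * .mono m Complex.I)
        = TrigPoly.ev x (P * .mono m 1) * Complex.I := by
      rw [map_mul, map_mul, TrigPoly.ev_mono, TrigPoly.ev_mono]
      ring
    rw [e1, Complex.sq_norm, Complex.normSq_apply, e2, Complex.mul_I_re]
    ring
  by_cases hcase : (∫ x, ‖TrigPoly.ev x P‖ ^ 2 ∂torusMeasure) / 2 ≤
      ∫ x, (TrigPoly.ev x (P * .mono m 1)).re ^ 2 ∂torusMeasure
  · exact ⟨1, by simp, hcase⟩
  · exact ⟨Complex.I, by simp, by linarith⟩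

/-- A polynomial of arbitrarily small integral norm can become bounded and of mean square at least
`1 / 4` after changes of signs of its coefficients. -/
theorem exists_signPair_isOscillating {ε : ℝ} (hε : 0 < ε) : ∃ h q : TrigPoly,
    h.SignPair q ∧ IsOscillating q ∧ h.coeff 0 = 0 ∧
      ∫ x, ‖TrigPoly.ev x h‖ ∂torusMeasure < ε := by
  obtain ⟨D, P, hP, hP1, hPint, hDε⟩ := exists_signPair_bounded hε
  obtain ⟨d, hd⟩ := D.exists_degree_bound
  -- The factor `e^{i(d+1)x}` moves the spectrum to positive frequencies, so that it does not meet
  -- its reflection when the real part is taken.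
  obtain ⟨u, hu, huint⟩ := exists_integral_re_sq_ge P (d + 1)
  have hnorm : ∀ (f : TrigPoly) (x : ℝ),
      |(TrigPoly.ev x (f * .mono (d + 1) u)).re| ≤ ‖TrigPoly.ev x f‖ := by
    intro f x
    refine (Complex.abs_re_le_norm _).trans (le_of_eq ?_)
    rw [map_mul, TrigPoly.ev_mono, norm_mul, norm_mul, norm_expFun, hu, mul_one, mul_one]
  have hDneg : ∀ k : ℤ, k ≤ 0 → (D * .mono (d + 1) u).coeff k = 0 := by
    intro k hk
    rw [TrigPoly.coeff_mul_mono, hd, zero_mul]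
    rw [lt_abs]
    omega
  have hpair : TrigPoly.SignPair (D * .mono (d + 1) u).rePart (P * .mono (d + 1) u).rePart := by
    have hF := hP.mul_mono (d + 1) u
    refine (hF.add hF.conj fun k => ?_).smul _
    rcases le_total k 0 with hk | hk
    · exact Or.inl (hDneg k hk)
    · right
      rw [TrigPoly.coeff_conj, hDneg (-k) (by omega), map_zero]
  have h0 : (D * .mono (d + 1) u).rePart.coeff 0 = 0 := by
    rw [TrigPoly.rePart, AddMonoidAlgebra.coeff_smul, AddMonoidAlgebra.coeff_add,
      Finsupp.smul_apply, Finsupp.add_apply, TrigPoly.coeff_conj, neg_zero, hDneg 0 le_rfl,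
      map_zero, add_zero, smul_zero]
  refine ⟨_, _, hpair, ⟨hpair.coeff_eq_zero h0, fun x => ?_, fun x => ?_, ?_⟩, h0, ?_⟩
  · rw [TrigPoly.ev_rePart, Complex.ofReal_im]
  · rw [TrigPoly.ev_rePart, Complex.ofReal_re]
    exact (hnorm P x).trans (hP1 x)
  · simp only [TrigPoly.ev_rePart, Complex.ofReal_re]
    linarith
  · refine lt_of_le_of_lt (integral_mono (TrigPoly.integrable_ev _).norm D.integrable_ev.norm
      fun x => ?_) hDε
    simp only [TrigPoly.ev_rePart, Complex.norm_real, Real.norm_eq_abs]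
    exact hnorm D x

/-! ### Products of Riesz type -/

theorem integral_norm_ev_dil (f : TrigPoly) {N : ℕ} (hN : 0 < N) :
    ∫ x, ‖TrigPoly.ev x (f.dil N)‖ ∂torusMeasure = ∫ x, ‖TrigPoly.ev x f‖ ∂torusMeasure := by
  simp only [TrigPoly.ev_dil]
  exact integral_dilation_eq f.continuous_ev.norm (fun x => congrArg norm (f.periodic_ev x)) hN

theorem integral_norm_ev_mul_dil_le {r : TrigPoly} {C : ℝ} (hr : ∀ x, ‖TrigPoly.ev x r‖ ≤ C)
    (f : TrigPoly) {N : ℕ} (hN : 0 < N) :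
    ∫ x, ‖TrigPoly.ev x (r * f.dil N)‖ ∂torusMeasure
      ≤ C * ∫ x, ‖TrigPoly.ev x f‖ ∂torusMeasure := by
  rw [← integral_norm_ev_dil f hN, ← integral_const_mul]
  refine integral_mono (TrigPoly.integrable_ev _).norm
    ((TrigPoly.integrable_ev _).norm.const_mul C) fun x => ?_
  simp only [map_mul, norm_mul]
  exact mul_le_mul_of_nonneg_right (hr x) (norm_nonneg _)

/-- The products `1 - q = ∏ (1 - qⱼ(Nⱼ x))`, with `qⱼ` oscillating and `Nⱼ` rapidly increasing, are
nonnegative of mean one, and the integrals of their square roots tend to zero. The signs can be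
changed so that `q` becomes arbitrarily small in the integral norm. -/
theorem exists_rieszProduct (n : ℕ) : ∀ ε : ℝ, 0 < ε → ∃ h q : TrigPoly, h.SignPair q ∧
    h.coeff 0 = 0 ∧ (∀ x, (TrigPoly.ev x q).im = 0) ∧ (∀ x, (TrigPoly.ev x q).re ≤ 1) ∧
    ∫ x, ‖TrigPoly.ev x h‖ ∂torusMeasure < ε ∧
    ∫ x, √(1 - (TrigPoly.ev x q).re) ∂torusMeasure < 10 * (47 / 48) ^ n := by
  induction n with
  | zero =>
    intro ε hε
    refine ⟨0, 0, .refl _, rfl, by simp, by simp, by simpa using hε, ?_⟩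
    simp only [map_zero, Complex.zero_re, sub_zero, Real.sqrt_one]
    rw [integral_const, measureReal_restrict_apply_univ, Real.volume_real_Icc_of_le
      (by linarith [Real.pi_pos]), smul_eq_mul]
    nlinarith [Real.pi_lt_d2]
  | succ n ih =>
    intro ε hε
    obtain ⟨h₁, q₁, hpair₁, hz₁, him₁, hre₁, hint₁, hsqrt₁⟩ := ih (ε / 2) (by positivity)
    obtain ⟨d, hd⟩ := h₁.exists_degree_bound
    obtain ⟨C, hC, hCr⟩ := (1 - q₁).exists_norm_ev_le
    -- The new factor is chosen after the bound `C` for the old product, which it multiplies.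
    obtain ⟨h₂, q₂, hpair₂, hosc, hz₂, hint₂⟩ :=
      exists_signPair_isOscillating (show 0 < ε / (2 * C) by positivity)
    have hrd : ∀ k : ℤ, (d : ℤ) < |k| → (1 - q₁).coeff k = 0 := by
      intro k hk
      have hk0 : (0 : ℤ) ≠ k := by
        rintro rfl
        rw [abs_zero] at hk
        omega
      have h1 : (1 : TrigPoly).coeff k = 0 := by
        rw [AddMonoidAlgebra.one_def, AddMonoidAlgebra.coeff_single, Finsupp.single_apply,
          if_neg hk0]
      rw [AddMonoidAlgebra.coeff_sub, Finsupp.sub_apply, h1, hpair₁.coeff_eq_zero (hd k hk),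
        sub_zero]
    have hcont : Continuous fun x => √(1 - (TrigPoly.ev x q₁).re) :=
      Real.continuous_sqrt.comp
        (continuous_const.sub (Complex.continuous_re.comp q₁.continuous_ev))
    have hlarge := hosc.eventually_integral_mul_sqrt_lt
      (hcont.continuousOn.integrableOn_compact isCompact_Icc) (fun x => Real.sqrt_nonneg _) hsqrt₁
    obtain ⟨N, hN, hNd⟩ := (hlarge.and (eventually_gt_atTop (2 * d))).exists
    have hpair := hpair₁.add (hpair₂.mul_dil hrd hNd) fun k => by
      by_cases hk : (d : ℤ) < |k|
      · exact Or.inl (hd k hk)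
      · exact Or.inr (TrigPoly.coeff_mul_dil_eq_zero hrd hz₂ (by omega))
    have hq : ∀ x, TrigPoly.ev x (q₁ + (1 - q₁) * q₂.dil N)
        = ((1 - (1 - (TrigPoly.ev x q₁).re) * (1 - (TrigPoly.ev (N * x) q₂).re) : ℝ) : ℂ) := by
      intro x
      rw [map_add, map_mul, map_sub, map_one, TrigPoly.ev_dil, ev_eq_re (him₁ x),
        ev_eq_re (hosc.im_eq_zero (N * x))]
      simp only [Complex.ofReal_re]
      push_cast
      ring
    refine ⟨_, _, hpair, ?_, fun x => ?_, fun x => ?_, ?_, ?_⟩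
    · rw [AddMonoidAlgebra.coeff_add, Finsupp.add_apply, hz₁,
        TrigPoly.coeff_mul_dil_eq_zero hrd hz₂ (by rw [abs_zero]; omega), add_zero]
    · rw [hq, Complex.ofReal_im]
    · rw [hq, Complex.ofReal_re]
      have := mul_nonneg (sub_nonneg.2 (hre₁ x))
        (sub_nonneg.2 ((le_abs_self _).trans (hosc.abs_re_le (N * x))))
      linarith
    · have h1 := integral_norm_ev_mul_dil_le hCr h₂ (show 0 < N by omega)
      have h2 : C * ∫ x, ‖TrigPoly.ev x h₂‖ ∂torusMeasure < C * (ε / (2 * C)) :=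
        mul_lt_mul_of_pos_left hint₂ hC
      have h3 : C * (ε / (2 * C)) = ε / 2 := by field_simp
      have h4 : ∫ x, ‖TrigPoly.ev x (h₁ + (1 - q₁) * h₂.dil N)‖ ∂torusMeasure
          ≤ ∫ x, (‖TrigPoly.ev x h₁‖ + ‖TrigPoly.ev x ((1 - q₁) * h₂.dil N)‖) ∂torusMeasure :=
        integral_mono (TrigPoly.integrable_ev _).norm
          ((TrigPoly.integrable_ev _).norm.add (TrigPoly.integrable_ev _).norm) fun x => by
            simp only [map_add]
            exact norm_add_le _ _
      rw [integral_add (TrigPoly.integrable_ev _).norm (TrigPoly.integrable_ev _).norm] at h4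
      linarith
    · have e : ∀ x, √(1 - (TrigPoly.ev x (q₁ + (1 - q₁) * q₂.dil N)).re)
          = √(1 - (TrigPoly.ev x q₁).re) * √(1 - (TrigPoly.ev (N * x) q₂).re) := by
        intro x
        rw [hq, Complex.ofReal_re, sub_sub_cancel, Real.sqrt_mul (sub_nonneg.2 (hre₁ x))]
      simp only [e]
      rw [pow_succ]
      linarith

/-- Powers with exponent `p < 1` are controlled by the square root, up to a small constant and a
small multiple of the first power. -/
theorem rpow_le_add_sqrt_add {p : ℝ} (hp0 : 0 < p) (hp1 : p < 1) {c : ℝ} (hc : 0 < c) :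
    ∃ A : ℝ, 0 < A ∧ ∀ t : ℝ, 0 ≤ t → t ^ p ≤ c + A * √t + c * t := by
  -- `κ ^ p = c` for small `t`, and `K ^ (p - 1) = c` for large `t`.
  set κ : ℝ := c ^ p⁻¹ with hκ
  set K : ℝ := c ^ (p - 1)⁻¹ with hK
  have hκ0 : 0 < κ := Real.rpow_pos_of_pos hc _
  have hK0 : 0 < K := Real.rpow_pos_of_pos hc _
  have hκp : κ ^ p = c := Real.rpow_inv_rpow hc.le hp0.ne'
  have hKp : K ^ (p - 1) = c := Real.rpow_inv_rpow hc.le (by linarith)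
  refine ⟨K ^ p / √κ, by positivity, fun t ht => ?_⟩
  have hA : 0 ≤ K ^ p / √κ * √t := by positivity
  have hct : 0 ≤ c * t := by positivity
  rcases le_total t κ with h1 | h1
  · have := Real.rpow_le_rpow ht h1 hp0.le
    linarith
  rcases le_total t K with h2 | h2
  · have h3 := Real.rpow_le_rpow ht h2 hp0.le
    have h4 : K ^ p ≤ K ^ p / √κ * √t := by
      rw [div_mul_eq_mul_div, le_div_iff₀ (by positivity)]
      exact mul_le_mul_of_nonneg_left (Real.sqrt_le_sqrt h1) (by positivity)
    linarith
  · have ht0 : 0 < t := hK0.trans_le h2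
    have h3 : t ^ p = t ^ (p - 1) * t := by
      rw [← Real.rpow_add_one ht0.ne', sub_add_cancel]
    have h4 : t ^ (p - 1) ≤ K ^ (p - 1) :=
      Real.rpow_le_rpow_of_nonpos hK0 h2 (by linarith)
    rw [h3]
    nlinarith

theorem exists_signPair_integral_rpow_lt {p : ℝ} (hp0 : 0 < p) (hp1 : p < 1) {ε η : ℝ}
    (hε : 0 < ε) (hη : 0 < η) : ∃ h q : TrigPoly, h.SignPair q ∧ h.coeff 0 = 0 ∧
      ∫ x, ‖TrigPoly.ev x h‖ ∂torusMeasure < ε ∧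
      ∫ x, ‖TrigPoly.ev x (1 - q)‖ ^ p ∂torusMeasure < η := by
  obtain ⟨A, hA, hAp⟩ := rpow_le_add_sqrt_add hp0 hp1 (show 0 < η / 16 by positivity)
  obtain ⟨n, hn⟩ := exists_pow_lt_of_lt_one (show (0 : ℝ) < η / (100 * A) by positivity)
    (show (47 / 48 : ℝ) < 1 by norm_num)
  obtain ⟨h, q, hpair, hz, him, hre, hint, hsqrt⟩ := exists_rieszProduct n ε hε
  refine ⟨h, q, hpair, hz, hint, ?_⟩
  have hcont : Continuous fun x => 1 - (TrigPoly.ev x q).re :=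
    continuous_const.sub (Complex.continuous_re.comp q.continuous_ev)
  have hi : ∀ {F : ℝ → ℝ}, Continuous F → Integrable F torusMeasure := fun hF =>
    hF.continuousOn.integrableOn_compact isCompact_Icc
  have hnorm : ∀ x, ‖TrigPoly.ev x (1 - q)‖ = 1 - (TrigPoly.ev x q).re := by
    intro x
    rw [map_sub, map_one, ev_eq_re (him x), ← Complex.ofReal_one, ← Complex.ofReal_sub,
      Complex.norm_real, Real.norm_of_nonneg (sub_nonneg.2 (by simpa using hre x))]
    simp
  have hconst : ∀ a : ℝ, ∫ _, a ∂torusMeasure = 2 * Real.pi * a := by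
    intro a
    rw [integral_const, measureReal_restrict_apply_univ, Real.volume_real_Icc_of_le
      (by linarith [Real.pi_pos]), smul_eq_mul]
    ring
  have hmean : ∫ x, (1 - (TrigPoly.ev x q).re) ∂torusMeasure = 2 * Real.pi := by
    have h0 := q.integral_ev
    rw [hpair.coeff_eq_zero hz, mul_zero] at h0
    have h1 : ∫ x, (TrigPoly.ev x q).re ∂torusMeasure = 0 := by
      have := integral_re q.integrable_ev
      simp only [RCLike.re_to_complex] at this
      rw [this, h0, Complex.zero_re]
    have h2 : Integrable (fun x => (TrigPoly.ev x q).re) torusMeasure :=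
      hi (Complex.continuous_re.comp q.continuous_ev)
    rw [integral_sub (integrable_const 1) h2, h1, hconst]
    ring
  have hi₁ : Integrable (fun x => A * √(1 - (TrigPoly.ev x q).re)) torusMeasure :=
    hi (continuous_const.mul (Real.continuous_sqrt.comp hcont))
  have hi₂ : Integrable (fun x => η / 16 * (1 - (TrigPoly.ev x q).re)) torusMeasure :=
    hi (continuous_const.mul hcont)
  have hi₃ : Integrable (fun x => η / 16 + A * √(1 - (TrigPoly.ev x q).re)) torusMeasure :=
    (integrable_const _).add hi₁
  have hle : ∫ x, ‖TrigPoly.ev x (1 - q)‖ ^ p ∂torusMeasure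
      ≤ ∫ x, (η / 16 + A * √(1 - (TrigPoly.ev x q).re) + η / 16 * (1 - (TrigPoly.ev x q).re))
        ∂torusMeasure := by
    refine integral_mono
      (hi ((TrigPoly.continuous_ev _).norm.rpow_const fun _ => Or.inr hp0.le))
      (hi₃.add hi₂) fun x => ?_
    simp only [hnorm]
    exact hAp _ (sub_nonneg.2 (hre x))
  rw [integral_add hi₃ hi₂, integral_add (integrable_const _) hi₁,
    integral_const_mul, integral_const_mul, hmean,
    hconst] at hle
  have h1 : A * ∫ x, √(1 - (TrigPoly.ev x q).re) ∂torusMeasure < η / 10 := by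
    calc A * ∫ x, √(1 - (TrigPoly.ev x q).re) ∂torusMeasure
        < A * (10 * (η / (100 * A))) := mul_lt_mul_of_pos_left (by linarith) hA
      _ = η / 10 := by field_simp; norm_num
  nlinarith [Real.pi_lt_d2, Real.pi_pos]

/-- Every trigonometric polynomial is approximated in `L^p`, `p < 1`, by a polynomial with high
frequencies that becomes small in `L¹` after changes of signs of its coefficients. -/
theorem exists_signPair_approx {p : ℝ} (hp0 : 0 < p) (hp1 : p < 1) (g : TrigPoly) (K : ℕ) {ε : ℝ}
    (hε : 0 < ε) : ∃ H Q : TrigPoly, H.SignPair Q ∧ (∀ k : ℤ, |k| ≤ K → H.coeff k = 0) ∧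
      ∫ x, ‖TrigPoly.ev x H‖ ∂torusMeasure < ε ∧
      eLpNorm (fun x => TrigPoly.ev x (Q - g)) (ENNReal.ofReal p) torusMeasure
        < ENNReal.ofReal ε := by
  obtain ⟨C, hC, hCg⟩ := g.exists_norm_ev_le
  obtain ⟨d, hd⟩ := g.exists_degree_bound
  obtain ⟨h, q, hpair, hz, hint, hpow⟩ := exists_signPair_integral_rpow_lt hp0 hp1
    (show 0 < ε / C by positivity) (show 0 < (ε / C) ^ p by positivity)
  have hN : 2 * d < 2 * d + K + 1 := by omega
  refine ⟨g * h.dil (2 * d + K + 1), g * q.dil (2 * d + K + 1), hpair.mul_dil hd hN,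
    fun k hk => TrigPoly.coeff_mul_dil_eq_zero hd hz (by push_cast; omega), ?_, ?_⟩
  · refine (integral_norm_ev_mul_dil_le hCg h (by omega)).trans_lt ?_
    calc C * ∫ x, ‖TrigPoly.ev x h‖ ∂torusMeasure < C * (ε / C) := mul_lt_mul_of_pos_left hint hC
      _ = ε := by field_simp
  · set N := 2 * d + K + 1
    have hcont := (g * q.dil N - g).continuous_ev
    obtain ⟨B, -, hB⟩ := (g * q.dil N - g).exists_norm_ev_le
    have hmem : MemLp (fun x => TrigPoly.ev x (g * q.dil N - g)) (ENNReal.ofReal p) torusMeasure :=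
      MemLp.of_bound hcont.aestronglyMeasurable B (Eventually.of_forall hB)
    have hi : ∀ {F : ℝ → ℝ}, Continuous F → Integrable F torusMeasure := fun hF =>
      hF.continuousOn.integrableOn_compact isCompact_Icc
    have hc1 : Continuous fun x => ‖TrigPoly.ev x (1 - q)‖ ^ p :=
      (TrigPoly.continuous_ev _).norm.rpow_const fun _ => Or.inr hp0.le
    rw [hmem.eLpNorm_eq_integral_rpow_norm (by simpa using hp0) ENNReal.ofReal_ne_top,
      ENNReal.toReal_ofReal hp0.le]
    refine (ENNReal.ofReal_lt_ofReal_iff hε).2 ?_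
    have hle : ∫ x, ‖TrigPoly.ev x (g * q.dil N - g)‖ ^ p ∂torusMeasure
        ≤ C ^ p * ∫ x, ‖TrigPoly.ev x (1 - q)‖ ^ p ∂torusMeasure := by
      rw [← integral_dilation_eq hc1 (fun x => congrArg (‖·‖ ^ p) ((1 - q).periodic_ev x))
        (show 0 < N by omega), ← integral_const_mul]
      refine integral_mono (hi (hcont.norm.rpow_const fun _ => Or.inr hp0.le))
        (hi (continuous_const.mul (hc1.comp (continuous_const.mul continuous_id)))) fun x => ?_
      have e : TrigPoly.ev x (g * q.dil N - g)
          = -(TrigPoly.ev x g * TrigPoly.ev (N * x) (1 - q)) := by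
        rw [map_sub, map_mul, TrigPoly.ev_dil, map_sub, map_one]
        ring
      simp only [e, norm_neg, norm_mul]
      rw [Real.mul_rpow (norm_nonneg _) (norm_nonneg _)]
      exact mul_le_mul_of_nonneg_right (Real.rpow_le_rpow (norm_nonneg _) (hCg x) hp0.le)
        (by positivity)
    have hlt : ∫ x, ‖TrigPoly.ev x (g * q.dil N - g)‖ ^ p ∂torusMeasure < ε ^ p := by
      refine hle.trans_lt ((mul_lt_mul_of_pos_left hpow (by positivity)).trans_eq ?_)
      rw [← Real.mul_rpow hC.le (by positivity), mul_div_cancel₀ _ hC.ne']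
    calc (∫ x, ‖TrigPoly.ev x (g * q.dil N - g)‖ ^ p ∂torusMeasure) ^ p⁻¹
        < (ε ^ p) ^ p⁻¹ := Real.rpow_lt_rpow
          (integral_nonneg fun x => by positivity) hlt (inv_pos.2 hp0)
      _ = ε := Real.rpow_rpow_inv hε.le hp0.ne'

/-! ### Trigonometric polynomials as elements of `L¹` -/

theorem abs_freq (n : ℕ) : |freq n| = ((n + 1) / 2 : ℕ) := by
  simp only [freq, Nat.even_iff]
  split_ifs with h
  · rw [abs_neg, Nat.abs_cast]
    omega
  · rw [Nat.abs_cast]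

theorem exists_freq_eq (k : ℤ) : ∃ n : ℕ, freq n = k ∧ n ≤ 2 * k.natAbs := by
  rcases lt_or_ge 0 k with hk | hk
  · refine ⟨2 * k.natAbs - 1, ?_, by omega⟩
    simp only [freq, Nat.even_iff]
    split_ifs <;> omega
  · refine ⟨2 * k.natAbs, ?_, le_rfl⟩
    simp only [freq, Nat.even_iff]
    split_ifs <;> omega

namespace TrigPoly

theorem memLp_ev (f : TrigPoly) (p : ℝ≥0∞) : MemLp (fun x => ev x f) p torusMeasure := by
  obtain ⟨C, -, hC⟩ := f.exists_norm_ev_le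
  exact MemLp.of_bound f.continuous_ev.aestronglyMeasurable C (Eventually.of_forall hC)

/-- The class in `L¹` of a trigonometric polynomial. -/
def toL1 : TrigPoly →ₗ[ℂ] L1 where
  toFun f := (f.memLp_ev 1).toLp _
  map_add' f g := by
    rw [← MemLp.toLp_add]
    congr 1
    ext x
    exact map_add _ _ _
  map_smul' c f := by
    rw [RingHom.id_apply, ← MemLp.toLp_const_smul]
    congr 1
    ext x
    exact map_smul _ _ _

theorem coeFn_toL1 (f : TrigPoly) : toL1 f =ᵐ[torusMeasure] fun x => ev x f :=
  (f.memLp_ev 1).coeFn_toLp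

theorem norm_toL1 (f : TrigPoly) : ‖toL1 f‖ = ∫ x, ‖ev x f‖ ∂torusMeasure := by
  rw [L1.norm_eq_integral_norm]
  refine integral_congr_ae ?_
  filter_upwards [f.coeFn_toL1] with x hx
  rw [hx]

theorem fourierCoefL1_toL1 (k : ℤ) (f : TrigPoly) : fourierCoefL1 k (toL1 f) = f.coeff k := by
  change (2 * Real.pi : ℂ)⁻¹ * ∫ x, expFun (-k) x * toL1 f x ∂torusMeasure = _
  have h : ∫ x, expFun (-k) x * toL1 f x ∂torusMeasure
      = ∫ x, ev x (f * mono (-k) 1) ∂torusMeasure := by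
    refine integral_congr_ae ?_
    filter_upwards [f.coeFn_toL1] with x hx
    rw [hx, map_mul, ev_mono]
    ring
  have hpi : (2 * Real.pi : ℂ) ≠ 0 := by
    exact_mod_cast (mul_pos two_pos Real.pi_pos).ne'
  rw [h, integral_ev, coeff_mul_mono, inv_mul_cancel_left₀ hpi, mul_one]
  congr 1
  ring

theorem toL1_mono (k : ℤ) (c : ℂ) :
    toL1 (mono k c) = c • (memLp_expFun k).toLp (expFun k) := by
  rw [← MemLp.toLp_const_smul]
  change ((mono k c).memLp_ev 1).toLp _ = _
  congr 1
  ext x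
  simp

theorem toL1_eq_sum {f : TrigPoly} {d : ℕ} (hd : ∀ k : ℤ, (d : ℤ) < |k| → f.coeff k = 0) :
    toL1 f = ∑ n ∈ Finset.range (2 * d + 1), f.coeff (freq n) • trigSystem.vec n := by
  have h : f = ∑ n ∈ Finset.range (2 * d + 1), mono (freq n) (f.coeff (freq n)) := by
    ext k
    rw [AddMonoidAlgebra.coeff_sum, Finsupp.finsetSum_apply]
    obtain ⟨m, rfl, hm⟩ := exists_freq_eq k
    rw [Finset.sum_eq_single m]
    · simp
    · intro n _ hn
      rw [coeff_mono, if_neg fun h => hn (freq_injective h)]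
    · intro hm'
      rw [coeff_mono, if_pos rfl]
      refine hd _ ?_
      rw [Finset.mem_range, not_lt] at hm'
      rw [abs_freq] at *
      omega
  conv_lhs => rw [h]
  rw [map_sum]
  exact Finset.sum_congr rfl fun n _ => toL1_mono _ _

end TrigPoly

/-! ### Upper density -/

/-- A set of indices containing intervals `[a, b)` with `a / b` arbitrarily small has upper density
one. -/
theorem upperDensity_eq_one {A : Set ℕ} (a : ℕ → ℕ)
    (h : ∀ k n, a k ≤ n → n < (k + 1) * a k → n ∈ A) (ha : ∀ k, k < a k) :
    upperDensity A = 1 := by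
  classical
  unfold upperDensity
  set u : ℕ → ℝ := fun n : ℕ =>
    (((Finset.range n).filter (fun m => m ∈ A)).card : ℝ) / (n : ℝ) with hu
  have hu1 : ∀ n, u n ≤ 1 := by
    intro n
    refine div_le_one_of_le₀ ?_ (Nat.cast_nonneg n)
    exact_mod_cast (Finset.card_filter_le _ _).trans (Finset.card_range n).le
  have hu0 : ∀ n, 0 ≤ u n := fun n => by positivity
  have hb : IsBoundedUnder (· ≤ ·) atTop u := isBoundedUnder_of ⟨1, hu1⟩
  have hcb : IsCoboundedUnder (· ≤ ·) atTop u :=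
    IsBoundedUnder.isCoboundedUnder_le (isBoundedUnder_of ⟨0, hu0⟩)
  have hlow : ∀ k : ℕ, 1 - 1 / ((k : ℝ) + 1) ≤ u ((k + 1) * a k) := by
    intro k
    have hak : (0 : ℝ) < a k := by exact_mod_cast (Nat.zero_le k).trans_lt (ha k)
    have hcard : (k + 1) * a k - a k
        ≤ ((Finset.range ((k + 1) * a k)).filter (fun m => m ∈ A)).card := by
      rw [← Nat.card_Ico]
      refine Finset.card_le_card fun n hn => ?_
      rw [Finset.mem_Ico] at hn
      exact Finset.mem_filter.2 ⟨Finset.mem_range.2 hn.2, h k n hn.1 hn.2⟩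
    have hcard' : (k : ℝ) * a k
        ≤ (((Finset.range ((k + 1) * a k)).filter (fun m => m ∈ A)).card : ℝ) := by
      have e : (k + 1) * a k - a k = k * a k := by
        rw [add_mul, one_mul, Nat.add_sub_cancel]
      rw [e] at hcard
      exact_mod_cast hcard
    rw [hu]
    simp only
    rw [le_div_iff₀ (by push_cast; positivity)]
    push_cast
    calc (1 - 1 / ((k : ℝ) + 1)) * (((k : ℝ) + 1) * a k) = k * a k := by field_simp; ring
      _ ≤ _ := hcard'
  refine le_antisymm (limsup_le_of_le hcb (Eventually.of_forall hu1)) ?_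
  refine le_of_forall_lt fun c hc => ?_
  obtain ⟨c', hcc', hc'⟩ := exists_between hc
  refine hcc'.trans_le (le_limsup_of_frequently_le ?_ hb)
  rw [frequently_atTop]
  intro m
  obtain ⟨k₀, hk₀⟩ := exists_nat_one_div_lt (sub_pos.2 hc')
  refine ⟨(max m k₀ + 1) * a (max m k₀), ?_, ?_⟩
  · have := ha (max m k₀)
    have := le_max_left m k₀
    nlinarith
  · refine le_trans ?_ (hlow (max m k₀))
    have : 1 / (((max m k₀ : ℕ) : ℝ) + 1) ≤ 1 / ((k₀ : ℝ) + 1) :=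
      one_div_le_one_div_of_le (by positivity)
        (by exact_mod_cast Nat.succ_le_succ (le_max_right m k₀))
    linarith

/-! ### The block construction -/

/-- The signs and the function for a prescribed sequence of targets: `A k` is the sum of the first
`k` blocks of the Fourier series of the function, `B k` is the signed sum of these blocks, and the
`k`-th block corrects `B k` towards the `k`-th target. Both have degree at most `d k`, and no
frequency between `d k` and `(k + 1) * (2 * d k + 1)` occurs. -/
theorem exists_blocks (g : ℕ → TrigPoly) (p : ℕ → ℝ) (hp0 : ∀ k, 0 < p k) (hp1 : ∀ k, p k < 1) :
    ∃ (A B : ℕ → TrigPoly) (d : ℕ → ℕ), ∀ k, (A k).SignPair (B k) ∧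
      (∀ j : ℤ, (d k : ℤ) < |j| → (A k).coeff j = 0) ∧
      (k + 1) * (2 * d k + 1) ≤ d (k + 1) ∧
      (∀ j : ℤ, |j| ≤ ((k + 1) * (2 * d k + 1) : ℕ) →
        (A (k + 1)).coeff j = (A k).coeff j ∧ (B (k + 1)).coeff j = (B k).coeff j) ∧
      ‖TrigPoly.toL1 (A (k + 1)) - TrigPoly.toL1 (A k)‖ ≤ (1 / 2) ^ k ∧
      eLpNorm (fun x => TrigPoly.ev x (B (k + 1) - g k)) (ENNReal.ofReal (p k)) torusMeasure
        < ENNReal.ofReal ((1 / 2) ^ k) := by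
  let State := {s : TrigPoly × TrigPoly × ℕ //
    s.1.SignPair s.2.1 ∧ ∀ j : ℤ, (s.2.2 : ℤ) < |j| → s.1.coeff j = 0}
  have step : ∀ (k : ℕ) (s : State), ∃ t : State, (k + 1) * (2 * s.1.2.2 + 1) ≤ t.1.2.2 ∧
      (∀ j : ℤ, |j| ≤ ((k + 1) * (2 * s.1.2.2 + 1) : ℕ) →
        t.1.1.coeff j = s.1.1.coeff j ∧ t.1.2.1.coeff j = s.1.2.1.coeff j) ∧
      ‖TrigPoly.toL1 t.1.1 - TrigPoly.toL1 s.1.1‖ ≤ (1 / 2) ^ k ∧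
      eLpNorm (fun x => TrigPoly.ev x (t.1.2.1 - g k)) (ENNReal.ofReal (p k)) torusMeasure
        < ENNReal.ofReal ((1 / 2) ^ k) := by
    rintro k ⟨⟨A, B, d⟩, hpair, hd⟩
    simp only at hpair hd
    obtain ⟨H, Q, hHQ, hlow, hint, hlp⟩ := exists_signPair_approx (hp0 k) (hp1 k) (g k - B)
      ((k + 1) * (2 * d + 1)) (show (0 : ℝ) < (1 / 2) ^ k by positivity)
    obtain ⟨e, he⟩ := H.exists_degree_bound
    have hdle : d ≤ (k + 1) * (2 * d + 1) := by nlinarith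
    refine ⟨⟨⟨A + H, B + Q, max e ((k + 1) * (2 * d + 1))⟩, hpair.add hHQ fun j => ?_,
      fun j hj => ?_⟩, le_max_right _ _, fun j hj => ?_, ?_, ?_⟩
    · by_cases hj : (d : ℤ) < |j|
      · exact Or.inl (hd j hj)
      · exact Or.inr (hlow j (by omega))
    · simp only at hj
      rw [AddMonoidAlgebra.coeff_add, Finsupp.add_apply, hd j (by omega), he j (by omega),
        add_zero]
    · have h1 := hlow j hj
      have h2 := hHQ.coeff_eq_zero h1
      simp only [AddMonoidAlgebra.coeff_add, Finsupp.add_apply, h1, h2, add_zero, and_self]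
    · simp only
      rw [← map_sub, add_sub_cancel_left, TrigPoly.norm_toL1]
      exact hint.le
    · simp only
      have e : B + Q - g k = Q - (g k - B) := by abel
      rw [e]
      exact hlp
  choose next hnext using step
  let s : ℕ → State := fun k => Nat.rec ⟨⟨0, 0, 0⟩, .refl 0, fun _ _ => rfl⟩ next k
  exact ⟨fun k => (s k).1.1, fun k => (s k).1.2.1, fun k => (s k).1.2.2, fun k =>
    ⟨(s k).2.1, (s k).2.2, hnext k (s k)⟩⟩

/-- For every sequence of trigonometric polynomials and of exponents less than one there are a
function in `L¹` and signs, equal to `1` on a set of upper density one, such that a subsequence of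
the signed partial sums of its Fourier series approximates the given sequence. -/
theorem exists_signed_series (g : ℕ → TrigPoly) (p : ℕ → ℝ) (hp0 : ∀ k, 0 < p k)
    (hp1 : ∀ k, p k < 1) :
    ∃ (U : L1) (δ : ℕ → ℂ), (∀ n, δ n ∈ ({1, -1} : Set ℂ)) ∧ upperDensity {m | δ m = 1} = 1 ∧
      ∃ (N : ℕ → ℕ) (B : ℕ → TrigPoly), StrictMono N ∧ ∀ k,
        ∑ n ∈ Finset.range (N k), (δ n * trigSystem.coef n U) • trigSystem.vec n
          = TrigPoly.toL1 (B k) ∧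
        eLpNorm (fun x => TrigPoly.ev x (B k - g k)) (ENNReal.ofReal (p k)) torusMeasure
          < ENNReal.ofReal ((1 / 2) ^ k) := by
  classical
  obtain ⟨A, B, d, hAB⟩ := exists_blocks g p hp0 hp1
  choose hpair hdeg hd hlow hnorm happrox using hAB
  set G : ℕ → ℕ := fun k => (k + 1) * (2 * d k + 1) with hG
  have hdlt : ∀ k, d k < d (k + 1) := fun k => by
    have := hd k
    nlinarith
  have hdmono : StrictMono d := strictMono_nat_of_lt_succ hdlt
  have hGmono : Monotone G := fun a b hab => by
    have := hdmono.monotone hab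
    exact Nat.mul_le_mul (by omega) (by omega)
  have hstable : ∀ k m, k ≤ m → ∀ j : ℤ, |j| ≤ (G k : ℤ) →
      (A m).coeff j = (A k).coeff j ∧ (B m).coeff j = (B k).coeff j := by
    intro k m hkm
    induction m, hkm using Nat.le_induction with
    | base => exact fun _ _ => ⟨rfl, rfl⟩
    | succ m hkm ih =>
      intro j hj
      have h1 := hlow m j (hj.trans (by exact_mod_cast hGmono hkm))
      have h2 := ih j hj
      exact ⟨h1.1.trans h2.1, h1.2.trans h2.2⟩
  have hcauchy : CauchySeq fun k => TrigPoly.toL1 (A k) := by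
    refine cauchySeq_of_le_geometric (1 / 2) 1 (by norm_num) fun k => ?_
    rw [dist_comm, dist_eq_norm, one_mul]
    exact hnorm k
  obtain ⟨U, hU⟩ := cauchySeq_tendsto_of_complete hcauchy
  have hcoef : ∀ k (j : ℤ), |j| ≤ (G k : ℤ) → fourierCoefL1 j U = (A k).coeff j := by
    intro k j hj
    have h1 := ((fourierCoefL1 j).continuous.tendsto U).comp hU
    refine tendsto_nhds_unique h1 (tendsto_const_nhds.congr' ?_)
    filter_upwards [eventually_ge_atTop k] with m hm
    rw [Function.comp, TrigPoly.fourierCoefL1_toL1, (hstable k m hm j hj).1]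
  have hfreqG : ∀ n, |freq n| ≤ (G n : ℤ) := fun n => by
    rw [abs_freq]
    have : n + 1 ≤ G n := Nat.le_mul_of_pos_right _ (by omega)
    omega
  -- Coefficients with frequency at most `G k` have reached their final values at stage `k`.
  have hfinal : ∀ n k, |freq n| ≤ (G k : ℤ) →
      (A n).coeff (freq n) = (A k).coeff (freq n) ∧
        (B n).coeff (freq n) = (B k).coeff (freq n) := by
    intro n k hk
    have h1 := hstable n (max n k) (le_max_left _ _) _ (hfreqG n)
    have h2 := hstable k (max n k) (le_max_right _ _) _ hk
    exact ⟨h1.1.symm.trans h2.1, h1.2.symm.trans h2.2⟩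
  set δ : ℕ → ℂ := fun n => if (B n).coeff (freq n) = (A n).coeff (freq n) then 1 else -1 with hδ
  have hδmul : ∀ n, δ n * trigSystem.coef n U = (B n).coeff (freq n) := by
    intro n
    have h1 : trigSystem.coef n U = (A n).coeff (freq n) := hcoef n _ (hfreqG n)
    rw [h1, hδ]
    simp only
    split_ifs with h
    · rw [one_mul, h]
    · rw [(hpair n (freq n)).resolve_left h, neg_one_mul]
  refine ⟨U, δ, fun n => ?_, ?_, fun k => 2 * d (k + 1) + 1, fun k => B (k + 1), fun a b hab => ?_,
    fun k => ⟨?_, happrox k⟩⟩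
  · simp only [hδ]
    split_ifs <;> simp
  · refine upperDensity_eq_one (fun k => 2 * d k + 1) (fun k n h1 h2 => ?_) fun k => ?_
    · have h3 : |freq n| ≤ (G k : ℤ) := by
        rw [abs_freq]
        simp only [hG]
        omega
      have h4 : (A k).coeff (freq n) = 0 := by
        refine hdeg k _ ?_
        rw [abs_freq]
        omega
      have h5 := hfinal n k h3
      simp only [hδ, Set.mem_ofPred_eq]
      rw [if_pos]
      rw [h5.1, h5.2, h4, (hpair k).coeff_eq_zero h4]
    · have := hdmono.id_le k
      simp only [id] at this
      omega
  · have := hdmono (Nat.succ_lt_succ hab)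
    simp only [Nat.succ_eq_add_one] at this
    simp only
    omega
  · rw [TrigPoly.toL1_eq_sum fun j hj => (hpair (k + 1)).coeff_eq_zero (hdeg (k + 1) j hj)]
    refine Finset.sum_congr rfl fun n hn => ?_
    rw [hδmul, (hfinal n (k + 1) ?_).2]
    rw [Finset.mem_range] at hn
    rw [abs_freq]
    have : d (k + 1) ≤ G (k + 1) := by simp only [hG]; nlinarith
    omega

/-! ### Density of trigonometric polynomials -/

/-- A sequence of trigonometric polynomials that is uniformly dense in the continuous functions on
the circle. -/
theorem exists_dense_seq_trigPoly [Fact (0 < 2 * Real.pi)] : ∃ g : ℕ → TrigPoly,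
    ∀ (φ : C(AddCircle (2 * Real.pi), ℂ)) (ε : ℝ), 0 < ε →
      ∃ n, ∀ x : ℝ, ‖φ x - TrigPoly.ev x (g n)‖ < ε := by
  set S := Submodule.span ℂ (Set.range (fourier (T := 2 * Real.pi))) with hS
  have hSev : ∀ φ ∈ S, ∃ f : TrigPoly, ∀ x : ℝ, φ x = TrigPoly.ev x f := by
    intro φ hφ
    induction hφ using Submodule.span_induction with
    | mem φ h =>
      obtain ⟨k, rfl⟩ := h
      refine ⟨.mono k 1, fun x => ?_⟩
      rw [fourier_coe_apply, TrigPoly.ev_mono, one_mul, expFun]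
      congr 1
      have : (Real.pi : ℂ) ≠ 0 := by exact_mod_cast Real.pi_ne_zero
      push_cast
      field_simp
    | zero => exact ⟨0, by simp⟩
    | add φ ψ _ _ h h' =>
      obtain ⟨f, hf⟩ := h
      obtain ⟨f', hf'⟩ := h'
      exact ⟨f + f', fun x => by rw [map_add, ContinuousMap.add_apply, hf, hf']⟩
    | smul c φ _ h =>
      obtain ⟨f, hf⟩ := h
      exact ⟨c • f, fun x => by rw [map_smul, ContinuousMap.smul_apply, hf]⟩
  have hdense : Dense (S : Set C(AddCircle (2 * Real.pi), ℂ)) :=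
    (Submodule.dense_iff_topologicalClosure_eq_top).2 span_fourier_closure_eq_top
  obtain ⟨t, htS, htc, htd⟩ := hdense.exists_countable_dense_subset
  obtain ⟨φ, rfl⟩ := htc.exists_eq_range htd.nonempty
  choose g hg using fun n => hSev (φ n) (htS (Set.mem_range_self n))
  refine ⟨g, fun ψ ε hε => ?_⟩
  obtain ⟨n, hn⟩ := DenseRange.exists_dist_lt htd ψ hε
  refine ⟨n, fun x => ?_⟩
  rw [← hg, ← dist_eq_norm]
  exact (ContinuousMap.dist_apply_le_dist _).trans_lt hn

/-- There is a sequence of trigonometric polynomials that is dense in every `L^p`, `p < ∞`. -/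
theorem exists_seq_trigPoly_eLpNorm_lt : ∃ g : ℕ → TrigPoly,
    ∀ (p : ℝ≥0∞), p ≠ ∞ → ∀ f : ℝ → ℂ, MemLp f p torusMeasure → ∀ ε : ℝ≥0∞, ε ≠ 0 →
      ∃ n, eLpNorm (fun x => f x - TrigPoly.ev x (g n)) p torusMeasure < ε := by
  have : Fact (0 < 2 * Real.pi) := ⟨Real.two_pi_pos⟩
  obtain ⟨g, hg⟩ := exists_dense_seq_trigPoly
  refine ⟨g, fun p hp f hf ε hε => ?_⟩
  have hmeas : torusMeasure
      = volume.restrict (Set.Ioc (-Real.pi) (-Real.pi + 2 * Real.pi)) := by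
    rw [show -Real.pi + 2 * Real.pi = Real.pi by ring]
    exact Measure.restrict_congr_set Ioc_ae_eq_Icc.symm
  rw [hmeas] at hf ⊢
  set F := AddCircle.liftIoc (2 * Real.pi) (-Real.pi) f with hFdef
  have hF : MemLp F p volume := hf.memLp_liftIoc
  set μ := volume.restrict (Set.Ioc (-Real.pi) (-Real.pi + 2 * Real.pi))
  obtain ⟨η, hη, hηε⟩ := exists_Lp_half ℂ μ p hε
  obtain ⟨φ, hφ, -⟩ := hF.exists_boundedContinuous_eLpNorm_sub_le hp hη.ne'
  obtain ⟨c, hc, hcη⟩ := ENNReal.exists_nnreal_pos_mul_lt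
    (ENNReal.rpow_ne_top_of_nonneg (inv_nonneg.2 ENNReal.toReal_nonneg) (measure_ne_top μ Set.univ))
    hη.ne' (a := μ Set.univ ^ p.toReal⁻¹)
  obtain ⟨n, hn⟩ := hg φ.toContinuousMap c hc
  refine ⟨n, ?_⟩
  have hmk := AddCircle.measurePreserving_mk (2 * Real.pi) (-Real.pi)
  have hFφ : AEStronglyMeasurable (F - ⇑φ) volume :=
    hF.1.sub φ.continuous.aestronglyMeasurable
  have h1 : eLpNorm ((F - ⇑φ) ∘ ((↑) : ℝ → AddCircle (2 * Real.pi))) p μ ≤ η := by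
    rw [eLpNorm_comp_measurePreserving hFφ hmk]
    exact hφ
  have hcont : Continuous fun x : ℝ => φ (x : AddCircle (2 * Real.pi)) - TrigPoly.ev x (g n) :=
    (φ.continuous.comp (AddCircle.continuous_mk' _)).sub (g n).continuous_ev
  have h2 : eLpNorm (fun x : ℝ => φ (x : AddCircle (2 * Real.pi)) - TrigPoly.ev x (g n)) p μ
      ≤ η := by
    refine (eLpNorm_le_of_ae_bound (C := c)
      (Eventually.of_forall fun x => (hn x).le)).trans ?_
    rw [mul_comm, ENNReal.ofReal_coe_nnreal]
    exact hcη.le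
  refine lt_of_eq_of_lt (eLpNorm_congr_ae ?_)
    (hηε _ _ (hFφ.comp_measurePreserving hmk) hcont.aestronglyMeasurable h1 h2)
  filter_upwards [ae_restrict_mem measurableSet_Ioc] with x hx
  simp only [Pi.add_apply, Function.comp, Pi.sub_apply, hFdef, AddCircle.liftIoc_coe_apply hx]
  ring

/-! ### Universality -/

/-- The signed series that serves all the spaces: its partial sums approximate every function of
`L^p`, for all `p < 1` and with arbitrarily large indices. -/
theorem exists_universal_series : ∃ (U : L1) (δ : ℕ → ℂ), (∀ n, δ n ∈ ({1, -1} : Set ℂ)) ∧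
    upperDensity {m | δ m = 1} = 1 ∧
      ∀ (p : ℝ≥0∞), 0 < p → p < 1 → ∀ f : ℝ → ℂ, MemLp f p torusMeasure → ∀ ε : ℝ≥0∞, ε ≠ 0 →
        ∃ᶠ N in atTop, eLpNorm (fun x => (∑ n ∈ Finset.range N,
          (δ n * trigSystem.coef n U) • trigSystem.vec n : L1) x - f x) p torusMeasure < ε := by
  obtain ⟨g, hg⟩ := exists_seq_trigPoly_eLpNorm_lt
  set q : ℕ → ℝ := fun k => 1 - 1 / ((k : ℝ) + 2) with hq
  have hq0 : ∀ k, 0 < q k := fun k => by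
    have : 1 / ((k : ℝ) + 2) < 1 := by
      rw [div_lt_one (by positivity)]
      linarith [(Nat.cast_nonneg k : (0 : ℝ) ≤ k)]
    simp only [hq]
    linarith
  have hq1 : ∀ k, q k < 1 := fun k => by
    have : 0 < 1 / ((k : ℝ) + 2) := by positivity
    simp only [hq]
    linarith
  -- Every polynomial of the dense sequence is a target infinitely often.
  obtain ⟨U, δ, hδ, hdens, N, B, hN, hB⟩ :=
    exists_signed_series (fun k => g k.unpair.1) q hq0 hq1
  refine ⟨U, δ, hδ, hdens, fun p hp0 hp1 f hf ε hε => ?_⟩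
  have hptop : p ≠ ∞ := (hp1.trans ENNReal.one_lt_top).ne
  obtain ⟨η, hη, hηε⟩ := exists_Lp_half ℂ torusMeasure p hε
  obtain ⟨n, hn⟩ := hg p hptop f hf η hη.ne'
  have hpq : ∀ᶠ k in atTop, p ≤ ENNReal.ofReal (q k) := by
    have h1 : Tendsto q atTop (𝓝 1) := by
      have h0 := (tendsto_one_div_add_atTop_nhds_zero_nat (𝕜 := ℝ)).comp (tendsto_add_atTop_nat 1)
      have h0' : Tendsto (fun k : ℕ => 1 / ((k : ℝ) + 2)) atTop (𝓝 0) := by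
        refine h0.congr fun k => ?_
        simp only [Function.comp, Nat.cast_add, Nat.cast_one]
        ring
      simpa [hq] using h0'.const_sub 1
    have h2 := (ENNReal.continuous_ofReal.tendsto 1).comp h1
    rw [ENNReal.ofReal_one] at h2
    exact (h2.eventually (lt_mem_nhds hp1)).mono fun k hk => le_of_lt hk
  set M : ℝ≥0∞ := (torusMeasure Set.univ + 1) ^ (1 / p.toReal) with hM
  have hMtop : M ≠ ∞ := ENNReal.rpow_ne_top_of_nonneg (by positivity)
    (ENNReal.add_ne_top.2 ⟨measure_ne_top _ _, ENNReal.one_ne_top⟩)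
  have hsmall : ∀ᶠ k : ℕ in atTop, ENNReal.ofReal ((1 / 2) ^ k) * M < η := by
    have h1 : Tendsto (fun k : ℕ => ((1 : ℝ) / 2) ^ k) atTop (𝓝 0) :=
      tendsto_pow_atTop_nhds_zero_of_lt_one (by norm_num) (by norm_num)
    have h2 := (ENNReal.continuous_ofReal.tendsto 0).comp h1
    have h3 := ENNReal.Tendsto.mul_const h2 (Or.inr hMtop)
    rw [ENNReal.ofReal_zero, zero_mul] at h3
    exact h3.eventually (gt_mem_nhds hη)
  obtain ⟨k₀, hk₀⟩ := eventually_atTop.1 (hpq.and hsmall)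
  rw [frequently_atTop]
  intro J
  set k := Nat.pair n (max k₀ J) with hk
  have hkge : max k₀ J ≤ k := Nat.right_le_pair _ _
  obtain ⟨hkp, hkM⟩ := hk₀ k ((le_max_left _ _).trans hkge)
  refine ⟨N k, ((le_max_right _ _).trans hkge).trans (hN.id_le k), ?_⟩
  obtain ⟨hsum, happrox⟩ := hB k
  rw [hk, Nat.unpair_pair, ← hk] at happrox
  rw [hsum]
  have hmeas := (TrigPoly.continuous_ev (B k - g n)).aestronglyMeasurable (μ := torusMeasure)
  have h1 : eLpNorm (fun x => TrigPoly.ev x (B k - g n)) p torusMeasure ≤ η := by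
    refine (eLpNorm_le_eLpNorm_mul_rpow_measure_univ hkp hmeas).trans
      ((mul_le_mul' happrox.le ?_).trans hkM.le)
    have hp0' : 0 < p.toReal := ENNReal.toReal_pos hp0.ne' hptop
    have hexp : p.toReal ≤ (ENNReal.ofReal (q k)).toReal :=
      ENNReal.toReal_mono ENNReal.ofReal_ne_top hkp
    refine (ENNReal.rpow_le_rpow le_self_add (sub_nonneg.2
      (one_div_le_one_div_of_le hp0' hexp))).trans
      (ENNReal.rpow_le_rpow_of_exponent_le le_add_self (sub_le_self _ (by positivity)))
  have hn' : eLpNorm (fun x => TrigPoly.ev x (g n) - f x) p torusMeasure ≤ η := by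
    refine le_of_eq_of_le (eLpNorm_congr_norm_ae (Eventually.of_forall fun x => ?_)) hn.le
    exact norm_sub_rev _ _
  refine lt_of_eq_of_lt (eLpNorm_congr_ae ?_) (hηε _ _ hmeas
    ((g n).continuous_ev.aestronglyMeasurable.sub hf.1) h1 hn')
  filter_upwards [(B k).coeFn_toL1] with x hx
  rw [Pi.add_apply, Pi.sub_apply, hx, map_sub]
  ring

end AlmostUniv

end


theorem corollary1 :
    ∃ U : AlmostUniv.L1,
      (∀ (p : ENNReal), 0 < p → ∀ hp : p < 1,
        AlmostUniv.IsAlmostUniversal {1, -1} (AlmostUniv.LpConv p) (AlmostUniv.toLp p hp.le)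
          AlmostUniv.trigSystem U) ∧
      AlmostUniv.IsAlmostUniversal {1, -1} AlmostUniv.MeasureConv AlmostUniv.toMeasFun
        AlmostUniv.trigSystem U ∧
      AlmostUniv.IsAlmostUniversal {1, -1} AlmostUniv.AEConv AlmostUniv.toMeasFun
        AlmostUniv.trigSystem U := by
  obtain ⟨U, δ, hδ, hdens, hU⟩ := AlmostUniv.exists_universal_series
  have hae : AlmostUniv.IsUniversalSeq AlmostUniv.AEConv (fun N => AlmostUniv.toMeasFun
      (∑ n ∈ Finset.range N,
        (δ n * AlmostUniv.trigSystem.coef n U) • AlmostUniv.trigSystem.vec n)) := by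
    intro f
    set μ := AlmostUniv.torusMeasure
    set S : ℕ → AlmostUniv.L1 := fun N => ∑ n ∈ Finset.range N,
        (δ n * AlmostUniv.trigSystem.coef n U) • AlmostUniv.trigSystem.vec n with hS
    -- `f` itself need not belong to any `L^p`, so its truncations are approximated in `L^{1/2}`.
    set F : ℕ → ℝ → ℂ := fun m => {x | ‖f x‖ ≤ m}.indicator f with hF
    have hFmeas : ∀ m, AEStronglyMeasurable (F m) μ := fun m =>
      (f.stronglyMeasurable.indicator
        (measurableSet_le f.stronglyMeasurable.norm.measurable measurable_const)).aestronglyMeasurable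
    have hFmem : ∀ m, MemLp (F m) (1 / 2) μ := fun m =>
      MemLp.of_bound (hFmeas m) m (Eventually.of_forall fun x => by
        by_cases hx : ‖f x‖ ≤ m
        · simp only [hF]
          rwa [Set.indicator_of_mem (by exact hx)]
        · simp only [hF]
          rw [Set.indicator_of_notMem (by exact hx), norm_zero]
          exact Nat.cast_nonneg m)
    have hFlim : ∀ x, Tendsto (fun m => F m x) atTop (𝓝 (f x)) := by
      intro x
      obtain ⟨m₀, hm₀⟩ := exists_nat_ge ‖f x‖
      refine tendsto_const_nhds.congr' ?_
      filter_upwards [eventually_ge_atTop m₀] with m hm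
      simp only [hF]
      rw [Set.indicator_of_mem]
      exact hm₀.trans (by exact_mod_cast hm)
    obtain ⟨N, hN, hNε⟩ := extraction_forall_of_frequently fun m : ℕ =>
      hU (1 / 2) (by simp) (by simp) (F m) (hFmem m)
        ((m : ℝ≥0∞) + 1)⁻¹ (by simp)
    have hconv : Tendsto (fun m => eLpNorm ((fun x => S (N m) x - F m x) - 0) (1 / 2) μ) atTop
        (𝓝 0) := by
      have h0 : Tendsto (fun m : ℕ => ((m : ℝ≥0∞) + 1)⁻¹) atTop (𝓝 0) := by
        have := (tendsto_add_atTop_iff_nat 1).2 ENNReal.tendsto_inv_nat_nhds_zero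
        simpa using this
      refine tendsto_of_tendsto_of_tendsto_of_le_of_le tendsto_const_nhds h0
        (fun _ => zero_le) fun m => ?_
      rw [sub_zero]
      exact (hNε m).le
    have hmeas := tendstoInMeasure_of_tendsto_eLpNorm (by simp)
      (fun m => (Lp.aestronglyMeasurable (S (N m))).sub (hFmeas m))
      aestronglyMeasurable_zero hconv
    obtain ⟨ns, hns, hlim⟩ := hmeas.exists_seq_tendsto_ae
    refine ⟨N ∘ ns, hN.comp hns, ?_⟩
    filter_upwards [hlim] with x hx
    have hadd := hx.add ((hFlim x).comp hns.tendsto_atTop)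
    have h : Tendsto (fun i => S (N (ns i)) x) atTop (𝓝 (f x)) := by simpa using hadd
    exact h
  refine ⟨U, fun p hp0 hp => ⟨δ, hδ, hdens, fun f => ?_⟩, ⟨δ, hδ, hdens, fun f => ?_⟩,
    δ, hδ, hdens, hae⟩
  · obtain ⟨N, hN, hNε⟩ := extraction_forall_of_frequently fun m : ℕ =>
      hU p hp0 hp f (Lp.memLp f) ((m : ℝ≥0∞) + 1)⁻¹ (by simp)
    refine ⟨N, hN, ?_⟩
    have h0 : Tendsto (fun m : ℕ => ((m : ℝ≥0∞) + 1)⁻¹) atTop (𝓝 0) := by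
      have := (tendsto_add_atTop_iff_nat 1).2 ENNReal.tendsto_inv_nat_nhds_zero
      simpa using this
    exact tendsto_of_tendsto_of_tendsto_of_le_of_le tendsto_const_nhds h0
      (fun _ => zero_le) fun m => (hNε m).le
  · obtain ⟨N, hN, hlim⟩ := hae f
    exact ⟨N, hN, tendstoInMeasure_of_tendsto_ae (fun n => AEEqFun.aestronglyMeasurable _) hlim⟩
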